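/- **Setting.** Let $m,p\ge 1$, $0<\alpha\le 1$, $T>0$, and let $\phi:\mathbb R^m\to\mathbb R^p$ be $\alpha$-Hölder continuous. Let $\theta\in\mathbb R^p$, and let $y:[0,T]\to\mathbb R$ satisfy $$y^{(m)}(t)=\theta^{\mathsf T}\phi(\xi(t)),\qquad \xi=(y,y',\dots,y^{(m-1)}),\qquad t\in[0,T],$$ where $y^{(m+1)}$ exists on $[0,T]$ and is Riemann integrable. For each $n$ one observes $z_{i,n}=y(iT/n)+w(iT/n)$, $i=1,\dots,n$. The noise $(w(t))_{t\in[0,T]}$ is square integrable with $\mathbb E\,w(t)=0$ and $\mathbb E[w(s)w(t)]=0$ for $s\ne t$, and $t\mapsto\mathbb E\,w(t)^2$ is Riemann integrable on $[0,T]$. **Differentiation filter.** Let $\rho:[0,1]\to(0,\infty)$ be Riemann integrable. For each $N$ put $\langle f,g\rangle_N=\frac1N\sum_{j=1}^N\rho(\frac jN)f(\frac jN)g(\frac jN)$, and let $p_N^0,\dots,p_N^{N-1}$ be polynomials with $\deg p_N^d=d$ that are orthogonal for $\langle\cdot,\cdot\rangle_N$. Choose window lengths $N=N(n)$ of exact order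 $n^{(2m+2)/(2m+3)}$ and spacings $s=s(n)$ with $1\le s\le N$. (Here $s=N$ gives disjoint windows and $s=1$ gives maximally overlapping ones.) There are $n'=\lfloor (n-N)/s\rfloor+1$ windows. The $i$-th window $(i=1,\dots,n')$ consists of the samples with indices $n_i+1,\dots,n_i+N$, where $n_i=(i-1)s$. Put $t_i=n_iT/n$, and for $d=0,\dots,m$ put $$\hat x_i^d=\frac{d!\,n^d}{N^{d+1}T^d\,\langle p_N^d,x^d\rangle_N}\sum_{j=1}^N\rho\!\left(\tfrac jN\right)p_N^d\!\left(\tfrac jN\right)z_{n_i+j,n}.$$ **Ridge estimator.** Let $\Phi$ be the $n'\times p$ matrix with rows $\phi(\xi(t_i))^{\mathsf T}$, and let $\hat\Phi$ be the matrix with rows $\phi(\hat x_i^0,\dots,\hat x_i^{m-1})^{\mathsf T}$. For $\lambda=\lambda(n)>0$ put $$R=\begin{pmatrix}0_{p\times p}\\ \Phi\end{pmatrix},\qquad \hat R=\begin{pmatrix}\lambda I_p\\ \hat\Phi\end{pmatrix},\qquad \hat u=(0_{p\times1},\hat x_1^m,\dots,\hat x_{n'}^m)^{\mathsf T},\qquad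 \hat\theta=\hat R^\dagger\hat u,$$ where $\dagger$ denotes the Moore–Penrose pseudoinverse. Assume that $R$ has rank $p$ for all large $n$. **Theorem.** Let $\lambda(n)$ be of exact order $\sqrt{n'}\,n^{-\alpha/(2m+3)}$, for instance $\lambda^*(n)=c\,\sqrt{n'}\,n^{-\alpha/(2m+3)}$ with any constant $c>0$. Then for all large $n$ one has $\lambda(n)<\sigma_{\min}(\Phi)$, the error $\hat\theta-\theta$ is integrable, and $$\mathbb E\,\|\hat\theta-\theta\|=O\!\left(n^{-\alpha/(2m+3)}\right)\qquad\text{as } n\to\infty .$$ -/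

import Mathlib

open Filter Topology MeasureTheory Asymptotics
open scoped NNReal Polynomial Matrix

noncomputable section

namespace Hyperjerk

/-! ### Riemann integrability -/

/-- `f` is Riemann integrable on `[a, b]`: the equally spaced Riemann sums converge, whatever point
of each of the `n` subintervals of length `(b - a) / n` is chosen to evaluate `f`. -/
def RiemannIntegrable (f : ℝ → ℝ) (a b : ℝ) : Prop :=
  ∃ I : ℝ, ∀ ε > 0, ∃ n₀ : ℕ, ∀ n : ℕ, n₀ ≤ n → ∀ τ : ℕ → ℝ,
    (∀ i < n, τ i ∈ Set.Icc (a + i * ((b - a) / n)) (a + (i + 1) * ((b - a) / n))) →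
      |(b - a) / n * ∑ i ∈ Finset.range n, f (τ i) - I| < ε

/-! ### Linear algebra: Moore-Penrose inverse and least singular value -/

/-- The four Penrose equations: `B` is a Moore-Penrose inverse of the real matrix `A`. -/
structure IsMoorePenrose {ι κ : Type*} [Fintype ι] [Fintype κ]
    (A : Matrix ι κ ℝ) (B : Matrix κ ι ℝ) : Prop where
  mul_mul_left : A * B * A = A
  mul_mul_right : B * A * B = B
  symm_left : (A * B)ᵀ = A * B
  symm_right : (B * A)ᵀ = B * A

theorem IsMoorePenrose.unique {ι κ : Type*} [Fintype ι] [Fintype κ]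
    {A : Matrix ι κ ℝ} {B C : Matrix κ ι ℝ}
    (hB : IsMoorePenrose A B) (hC : IsMoorePenrose A C) : B = C := by
  have h1 : A * B = A * C := by
    calc A * B = (A * B)ᵀ := hB.symm_left.symm
      _ = (A * C * A * B)ᵀ := by rw [hC.mul_mul_left]
      _ = (A * B)ᵀ * (A * C)ᵀ := by rw [Matrix.mul_assoc (A * C), Matrix.transpose_mul]
      _ = A * B * A * C := by rw [hB.symm_left, hC.symm_left, Matrix.mul_assoc (A * B)]
      _ = A * C := by rw [hB.mul_mul_left]
  have h2 : B * A = C * A := by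
    calc B * A = (B * A)ᵀ := hB.symm_right.symm
      _ = (B * (A * C * A))ᵀ := by rw [hC.mul_mul_left]
      _ = (C * A)ᵀ * (B * A)ᵀ := by
        rw [← Matrix.transpose_mul]; simp only [Matrix.mul_assoc]
      _ = C * (A * B * A) := by
        rw [hB.symm_right, hC.symm_right]; simp only [Matrix.mul_assoc]
      _ = C * A := by rw [hB.mul_mul_left]
  calc B = B * A * B := hB.mul_mul_right.symm
    _ = C * A * C := by rw [h2, Matrix.mul_assoc, h1, ← Matrix.mul_assoc]
    _ = C := hC.mul_mul_right

theorem exists_isMoorePenrose {ι κ : Type*} [Fintype ι] [Fintype κ] (A : Matrix ι κ ℝ) :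
    ∃ B : Matrix κ ι ℝ, IsMoorePenrose A B := by
  classical
  have hH : (Aᵀ * A).IsHermitian := by
    simpa using Matrix.isHermitian_conjTranspose_mul_self A
  obtain ⟨G, hGt, hc, h1, h2⟩ : ∃ G : Matrix κ κ ℝ, Gᵀ = G ∧ G * (Aᵀ * A) = Aᵀ * A * G ∧
      Aᵀ * A * G * (Aᵀ * A) = Aᵀ * A ∧ G * (Aᵀ * A) * G = G := by
    obtain ⟨U, D, hU, hE⟩ : ∃ (U : Matrix κ κ ℝ) (D : κ → ℝ), Uᵀ * U = 1 ∧
        Aᵀ * A = U * Matrix.diagonal D * Uᵀ := by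
      refine ⟨hH.eigenvectorUnitary, hH.eigenvalues, ?_, ?_⟩
      · have := Unitary.coe_star_mul_self hH.eigenvectorUnitary
        simpa [Matrix.star_eq_conjTranspose] using this
      · have := hH.spectral_theorem
        simpa [Unitary.conjStarAlgAut_apply, Matrix.star_eq_conjTranspose, Function.comp_def]
          using this
    have key : ∀ a b : κ → ℝ, (U * Matrix.diagonal a * Uᵀ) * (U * Matrix.diagonal b * Uᵀ) =
        U * Matrix.diagonal (fun k => a k * b k) * Uᵀ := by
      intro a b
      calc (U * Matrix.diagonal a * Uᵀ) * (U * Matrix.diagonal b * Uᵀ)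
          = U * Matrix.diagonal a * (Uᵀ * U) * Matrix.diagonal b * Uᵀ := by
            simp only [Matrix.mul_assoc]
        _ = _ := by
            rw [hU, Matrix.mul_one, Matrix.mul_assoc U, Matrix.diagonal_mul_diagonal]
    refine ⟨U * Matrix.diagonal (fun k => (D k)⁻¹) * Uᵀ, ?_, ?_, ?_, ?_⟩
    · simp [Matrix.transpose_mul, Matrix.mul_assoc]
    · rw [hE, key, key]; simp only [mul_comm]
    · rw [hE, key, key]; simp only [mul_inv_mul_cancel]
    · rw [hE, key, key]
      congr 3; funext k
      by_cases h : D k = 0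
      · simp [h]
      · field_simp
  refine ⟨G * Aᵀ, ?_, ?_, ?_, ?_⟩
  · rw [← sub_eq_zero, ← Matrix.conjTranspose_mul_self_eq_zero]
    have hM : Aᵀ * (A * (G * Aᵀ) * A - A) = 0 := by
      rw [Matrix.mul_sub, sub_eq_zero]
      simpa only [Matrix.mul_assoc] using h1
    have ht : (A * (G * Aᵀ) * A - A)ᴴ = (Aᵀ * A * G - 1) * Aᵀ := by
      simp [Matrix.transpose_mul, Matrix.mul_assoc, hGt, Matrix.sub_mul]
    rw [ht, Matrix.mul_assoc, hM, Matrix.mul_zero]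
  · calc G * Aᵀ * A * (G * Aᵀ) = (G * (Aᵀ * A) * G) * Aᵀ := by simp only [Matrix.mul_assoc]
      _ = _ := by rw [h2]
  · simp [Matrix.transpose_mul, Matrix.mul_assoc, hGt]
  · rw [Matrix.mul_assoc, Matrix.transpose_mul, hGt, hc]
    simp [Matrix.transpose_mul]

/-- The Moore-Penrose pseudoinverse of a real matrix. -/
def pinv {ι κ : Type*} [Fintype ι] [Fintype κ] (A : Matrix ι κ ℝ) : Matrix κ ι ℝ :=
  (exists_isMoorePenrose A).choose

/-- The least singular value of a matrix with `p` columns, that is the last one of its `p` singular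
values in decreasing order. -/
def sigmaMin {ι : Type*} [Fintype ι] {p : ℕ} (A : Matrix ι (Fin p) ℝ) : ℝ :=
  (Matrix.toLpLin 2 2 A).singularValues (p - 1)

/-! ### The system -/

/-- The `d`-th derivative of `y : [0, T] → ℝ` (one-sided at the end points). -/
def timeDeriv (T : ℝ) (y : ℝ → ℝ) (d : ℕ) (t : ℝ) : ℝ :=
  iteratedDerivWithin d y (Set.Icc 0 T) t

/-- The state `ξ(t) = (y(t), y'(t), …, y^(m-1)(t))`. -/
def state (T : ℝ) (y : ℝ → ℝ) (m : ℕ) (t : ℝ) : EuclideanSpace ℝ (Fin m) :=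
  WithLp.toLp 2 fun k => timeDeriv T y k t

/-- `y` solves `y^(m) = θᵀ φ(ξ)` on `[0, T]`; moreover `y^(m+1)` exists on `[0, T]` and is Riemann
integrable there. -/
structure IsTrajectory {m p : ℕ} (φ : EuclideanSpace ℝ (Fin m) → EuclideanSpace ℝ (Fin p))
    (θ : EuclideanSpace ℝ (Fin p)) (T : ℝ) (y : ℝ → ℝ) : Prop where
  differentiable : ∀ d ≤ m, DifferentiableOn ℝ (timeDeriv T y d) (Set.Icc 0 T)
  integrable : RiemannIntegrable (timeDeriv T y (m + 1)) 0 T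
  ode : ∀ t ∈ Set.Icc 0 T, timeDeriv T y m t = inner ℝ θ (φ (state T y m t))

/-- Measurement noise: square integrable, centred, uncorrelated at different times, with a Riemann
integrable second moment. -/
structure IsNoise {Ω : Type*} [MeasurableSpace Ω] (P : Measure Ω) (T : ℝ) (w : ℝ → Ω → ℝ) :
    Prop where
  memLp : ∀ t ∈ Set.Icc 0 T, MemLp (w t) 2 P
  centred : ∀ t ∈ Set.Icc 0 T, ∫ ω, w t ω ∂P = 0
  uncorrelated : ∀ s ∈ Set.Icc 0 T, ∀ t ∈ Set.Icc 0 T, s ≠ t → ∫ ω, w s ω * w t ω ∂P = 0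
  integrable : RiemannIntegrable (fun t => ∫ ω, w t ω ^ 2 ∂P) 0 T

/-- The data `z_{i,n} = y(iT/n) + w(iT/n)`, for `i = 1, …, n`. -/
def sample {Ω : Type*} (T : ℝ) (y : ℝ → ℝ) (w : ℝ → Ω → ℝ) (n : ℕ) (ω : Ω) (i : ℕ) : ℝ :=
  y (i * T / n) + w (i * T / n) ω

/-! ### The differentiation filter -/

/-- `⟨f, g⟩_N = N⁻¹ ∑_{j=1}^N ρ(j/N) f(j/N) g(j/N)`. -/
def discreteInner (ρ : ℝ → ℝ) (N : ℕ) (f g : ℝ[X]) : ℝ :=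
  1 / N * ∑ j ∈ Finset.Icc 1 N, ρ (j / N) * f.eval ((j : ℝ) / N) * g.eval ((j : ℝ) / N)

/-- `q 0, …, q (N-1)` are polynomials with `deg (q d) = d`, orthogonal for `⟨·, ·⟩_N`. -/
structure IsOrthogonalFamily (ρ : ℝ → ℝ) (N : ℕ) (q : ℕ → ℝ[X]) : Prop where
  degree_eq : ∀ d < N, (q d).degree = d
  orthogonal : ∀ d < N, ∀ e < N, d ≠ e → discreteInner ρ N (q d) (q e) = 0

/-- The filter estimate of the `d`-th derivative at time `kT/n` from the window
`z_{k+1}, …, z_{k+N}`: it is `C ∑_{j=1}^N ρ(j/N) q_d(j/N) z_{k+j}`, where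
`C = d! n^d / (N^(d+1) T^d h)` and `h = ⟨q_d, x^d⟩_N`. -/
def filterEstimate (ρ : ℝ → ℝ) (q : ℕ → ℝ[X]) (T : ℝ) (n N : ℕ) (z : ℕ → ℝ) (k d : ℕ) : ℝ :=
  (d.factorial * (n : ℝ) ^ d) /
      ((N : ℝ) ^ (d + 1) * T ^ d * discreteInner ρ N (q d) (Polynomial.X ^ d)) *
    ∑ j ∈ Finset.Icc 1 N, ρ (j / N) * (q d).eval ((j : ℝ) / N) * z (k + j)

/-- The number of windows of `N` consecutive samples out of `n` when the window starts are spaced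
by `s`. It is `⌊n / N⌋` for disjoint windows (`s = N`) and `n - N + 1` for `s = 1`. -/
def numWindows (n N s : ℕ) : ℕ := (n + s - N) / s

/-! ### Ridge regression -/

section Estimator

variable {m p : ℕ} (φ : EuclideanSpace ℝ (Fin m) → EuclideanSpace ℝ (Fin p))

/-- The matrix `Φ` with rows `φ(P x_i)ᵀ`, where `P x_i` is the state at the start time
`t_i = i s T / n` of the `i`-th window (`i = 0, 1, …`). -/
def regressors (T : ℝ) (y : ℝ → ℝ) (n N s : ℕ) : Matrix (Fin (numWindows n N s)) (Fin p) ℝ :=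
  Matrix.of fun i k => φ (state T y m (((i : ℕ) * s : ℕ) * T / n)) k

/-- The matrix `R`, with blocks `0` and `Φ`. -/
def designMatrix (T : ℝ) (y : ℝ → ℝ) (n N s : ℕ) :
    Matrix (Fin p ⊕ Fin (numWindows n N s)) (Fin p) ℝ :=
  Matrix.fromRows 0 (regressors φ T y n N s)

/-- The filter estimate `P x̂_i` of the state at the start of the `i`-th window. -/
def stateHat (ρ : ℝ → ℝ) (q : ℕ → ℝ[X]) (T : ℝ) (n N s : ℕ) (z : ℕ → ℝ) (i : ℕ) :
    EuclideanSpace ℝ (Fin m) :=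
  WithLp.toLp 2 fun d => filterEstimate ρ q T n N z (i * s) d

/-- The matrix `R̂`, with blocks `λ I` and `Φ̂`, where `Φ̂` has the rows `φ(P x̂_i)ᵀ`. -/
def designMatrixHat (ρ : ℝ → ℝ) (q : ℕ → ℝ[X]) (T : ℝ) (n N s : ℕ) (lam : ℝ) (z : ℕ → ℝ) :
    Matrix (Fin p ⊕ Fin (numWindows n N s)) (Fin p) ℝ :=
  Matrix.fromRows (lam • (1 : Matrix (Fin p) (Fin p) ℝ))
    (Matrix.of fun i k => φ (stateHat ρ q T n N s z i) k)

/-- The vector `û`, with blocks `0` and `(x̂_i^m)_i`. -/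
def responseHat (m p : ℕ) (ρ : ℝ → ℝ) (q : ℕ → ℝ[X]) (T : ℝ) (n N s : ℕ) (z : ℕ → ℝ) :
    Fin p ⊕ Fin (numWindows n N s) → ℝ :=
  Sum.elim 0 fun i => filterEstimate ρ q T n N z (i * s) m

/-- The estimator `θ̂ = R̂† û`, a function of the data `z_1, …, z_n`. -/
def thetaHat (ρ : ℝ → ℝ) (q : ℕ → ℝ[X]) (T : ℝ) (n N s : ℕ) (lam : ℝ) (z : ℕ → ℝ) :
    EuclideanSpace ℝ (Fin p) :=
  WithLp.toLp 2 (pinv (designMatrixHat φ ρ q T n N s lam z) *ᵥ responseHat m p ρ q T n N s z)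

end Estimator

end Hyperjerk

end

/-!
# Convergence rate of the regularized parameter estimator

Put `a = n ^ (-1 / (2 m + 3))` (`filterRate`). The estimator solves the ridge regression problem
with the design `Φ̂` and the response `û` computed from filtered data, in place of the exact `Φ` and
`u = Φ θ`. The proof bounds the filter errors, shows that `Φ` is well conditioned, and combines
both by a perturbation inequality that holds for every realization of the noise.

*Filter.* By orthogonality the weights of the `d`-th filter annihilate polynomials of degree less
than `d` and reproduce the `d`-th derivative of `x ^ d`, so Taylor's formula of order `d` gives a
bias of order `N / n`. The variance is controlled by the sum of the squared weights, which has order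
`(n / N) ^ (2 d) / N` (`exists_filterWeight_bound`). This needs a lower bound, uniform in `N`, for
the discrete norm of a polynomial of degree `d` with leading coefficient one. Such a bound follows
from finite differences on an interval where the weight `ρ` is bounded below
(`exists_leadingCoeff_sq_le_discreteInner`); that interval exists because a positive Riemann
integrable function cannot have zero integral. For the window length `N` of exact order `n a`, bias
and variance together give a mean square error of order `a ^ 2` for all orders `d ≤ m`, uniformly
over the windows (`exists_filterEstimate_rate`).

*Conditioning.* Full rank of the design for one single sample size provides finitely many times `t`
such that every vector `v` has a component of size at least `c ‖v‖` along some `φ (ξ t)`. By uniform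
continuity this persists on an interval around `t`, and a fixed proportion of the windows of any
large sample starts in that interval. Hence the least singular value of `Φ` is at least of order
`√n'` (`exists_le_norm_regressors`), which exceeds `lam` eventually.

*Perturbation.* With `σ` the least singular value of `Φ`, the normal equations give the bound of
`ridge_error_le` for the error. It needs no smallness of `Φ̂ - Φ`: if `‖Φ̂ - Φ‖ > σ / 2`, then the
crude bound due to the regularization is multiplied by `2 ‖Φ̂ - Φ‖ / σ > 1`. All terms are at
most quadratic in the filter errors, so that expectations can be taken directly. By Hölder
continuity the squared errors of the design and of the response sum to at most a multiple of
`n' a ^ (2 α)` times one plus the mean squared filter error in units of `a ^ 2`. Inserting the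
orders of `lam` and `σ` gives an error of at most a constant times `a ^ α` times such a factor
(`norm_thetaHat_sub_le`), and `a ^ α = n ^ (-α / (2 m + 3))`.
-/

namespace Hyperjerk

/-! ### Riemann integrable functions -/

lemma exists_mem_cell {a b x : ℝ} (hab : a < b) (hx : x ∈ Set.Icc a b) {n : ℕ} (hn : 0 < n) :
    ∃ i < n, x ∈ Set.Icc (a + i * ((b - a) / n)) (a + (i + 1) * ((b - a) / n)) := by
  have hn' : (0 : ℝ) < n := by exact_mod_cast hn
  have hh : 0 < (b - a) / n := div_pos (sub_pos.2 hab) hn'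
  rcases eq_or_lt_of_le hx.2 with rfl | hxb
  · refine ⟨n - 1, by omega, ?_, ?_⟩
    · rw [Nat.cast_sub hn, ← le_sub_iff_add_le', ← le_div_iff₀ hh, div_div_cancel₀ (by linarith)]
      simp
    · rw [Nat.cast_sub hn]
      apply le_of_eq
      push_cast
      field_simp
      ring
  · have h0 : 0 ≤ (x - a) / ((b - a) / n) := div_nonneg (sub_nonneg.2 hx.1) hh.le
    refine ⟨⌊(x - a) / ((b - a) / n)⌋₊, ?_, ?_, ?_⟩
    · rw [Nat.floor_lt h0, div_lt_iff₀ hh]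
      have : (n : ℝ) * ((b - a) / n) = b - a := by field_simp
      linarith
    · have := Nat.floor_le h0
      rw [le_div_iff₀ hh] at this
      linarith
    · have := (Nat.lt_floor_add_one ((x - a) / ((b - a) / n))).le
      rw [div_le_iff₀ hh] at this
      linarith

/-- A Riemann integrable function is bounded: moving a single tag changes a Riemann sum with fixed
mesh by a bounded amount. -/
theorem RiemannIntegrable.exists_bound {f : ℝ → ℝ} {a b : ℝ} (hab : a < b)
    (hf : RiemannIntegrable f a b) : ∃ M, 0 ≤ M ∧ ∀ x ∈ Set.Icc a b, |f x| ≤ M := by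
  obtain ⟨I, hI⟩ := hf
  obtain ⟨n₀, h₀⟩ := hI 1 one_pos
  have h₁ := h₀ (n₀ + 1) (Nat.le_succ _)
  have hn : 0 < n₀ + 1 := Nat.succ_pos _
  generalize n₀ + 1 = n at h₁ hn
  have hn' : (0 : ℝ) < n := by exact_mod_cast hn
  set h := (b - a) / n with hh_def
  have hh : 0 < h := div_pos (sub_pos.2 hab) hn'
  let l : ℕ → ℝ := fun i => a + i * h
  have hl : ∀ i < n, l i ∈ Set.Icc (a + i * h) (a + (i + 1) * h) := fun i _ =>
    ⟨le_rfl, by simp only [l]; nlinarith⟩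
  have hS : 0 ≤ ∑ i ∈ Finset.range n, |f (l i)| := Finset.sum_nonneg fun i _ => abs_nonneg _
  refine ⟨(∑ i ∈ Finset.range n, |f (l i)|) + 2 / h, by positivity, fun x hx => ?_⟩
  obtain ⟨i, hi, hxi⟩ := exists_mem_cell hab hx hn
  have hA := abs_lt.1 (h₁ l hl)
  have hB := abs_lt.1 (h₁ (Function.update l i x) fun j hj => by
    by_cases hji : j = i
    · subst hji; simpa using hxi
    · rw [Function.update_of_ne hji]; exact hl j hj)
  have hsum : ∑ j ∈ Finset.range n, f (Function.update l i x j) =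
      f x - f (l i) + ∑ j ∈ Finset.range n, f (l j) := by
    have him := Finset.mem_range.2 hi
    rw [← Finset.add_sum_erase _ _ him, ← Finset.add_sum_erase _ (fun j => f (l j)) him]
    have : ∑ j ∈ (Finset.range n).erase i, f (Function.update l i x j) =
        ∑ j ∈ (Finset.range n).erase i, f (l j) :=
      Finset.sum_congr rfl fun j hj => by rw [Function.update_of_ne (Finset.ne_of_mem_erase hj)]
    rw [this, Function.update_self]
    ring
  rw [hsum, mul_add] at hB
  have hd : |f x - f (l i)| ≤ 2 / h := by
    rw [le_div_iff₀ hh, ← abs_of_pos hh, ← abs_mul, abs_le]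
    constructor <;> nlinarith
  have hle : |f (l i)| ≤ ∑ i ∈ Finset.range n, |f (l i)| :=
    Finset.single_le_sum (f := fun i => |f (l i)|) (fun j _ => abs_nonneg _)
      (Finset.mem_range.2 hi)
  have := abs_sub_abs_le_abs_sub (f x) (f (l i))
  linarith

/-- A positive Riemann integrable function is bounded below by a positive constant on some interval.
Otherwise suitable tags show that its integral vanishes, so that each set `{ρ ≥ 1 / k}` can be
covered by intervals of arbitrarily small total length, and these sets would exhaust `[0, 1]`. -/
theorem RiemannIntegrable.exists_subinterval_le {ρ : ℝ → ℝ}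
    (hpos : ∀ x ∈ Set.Icc (0 : ℝ) 1, 0 < ρ x) (hρ : RiemannIntegrable ρ 0 1) :
    ∃ c > 0, ∃ u v : ℝ, 0 ≤ u ∧ u < v ∧ v ≤ 1 ∧ ∀ x ∈ Set.Icc u v, c ≤ ρ x := by
  by_contra! H
  obtain ⟨I, hI⟩ := hρ
  simp only [sub_zero, zero_add] at hI
  have hcell : ∀ {n i : ℕ}, i < n → ∀ x ∈ Set.Icc ((i : ℝ) * (1 / n)) ((i + 1) * (1 / n)),
      x ∈ Set.Icc (0 : ℝ) 1 := by
    intro n i hi x hx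
    have hn : (0 : ℝ) < n := by exact_mod_cast (by omega : 0 < n)
    have hi' : (i : ℝ) + 1 ≤ n := by exact_mod_cast hi
    refine ⟨le_trans (by positivity) hx.1, hx.2.trans ?_⟩
    rw [mul_one_div, div_le_one hn]
    exact hi'
  have hI0 : I ≤ 0 := by
    refine le_of_forall_pos_le_add fun ε hε => ?_
    obtain ⟨n₀, h₀⟩ := hI (ε / 2) (half_pos hε)
    have hex : ∀ i : ℕ, ∃ x, i < n₀ + 1 →
        x ∈ Set.Icc ((i : ℝ) * (1 / (n₀ + 1 : ℕ))) ((i + 1) * (1 / (n₀ + 1 : ℕ))) ∧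
          ρ x < ε / 2 := by
      intro i
      by_cases hi : i < n₀ + 1
      · have hlt : (i : ℝ) * (1 / (n₀ + 1 : ℕ)) < (i + 1) * (1 / (n₀ + 1 : ℕ)) := by
          have : (0 : ℝ) < 1 / (n₀ + 1 : ℕ) := by positivity
          nlinarith
        obtain ⟨x, hx, hx'⟩ := H (ε / 2) (half_pos hε) _ _
          (hcell hi _ (Set.left_mem_Icc.2 hlt.le)).1 hlt
          (hcell hi _ (Set.right_mem_Icc.2 hlt.le)).2
        exact ⟨x, fun _ => ⟨hx, hx'⟩⟩
      · exact ⟨0, fun h => absurd h hi⟩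
    choose τ hτ using hex
    have h1 := (abs_lt.1 (h₀ (n₀ + 1) (Nat.le_succ _) τ fun i hi => (hτ i hi).1)).1
    have h2 : ∑ i ∈ Finset.range (n₀ + 1), ρ (τ i) ≤ ∑ i ∈ Finset.range (n₀ + 1), ε / 2 :=
      Finset.sum_le_sum fun i hi => (hτ i (Finset.mem_range.1 hi)).2.le
    rw [Finset.sum_const, Finset.card_range, nsmul_eq_mul] at h2
    have h3 : 1 / ((n₀ + 1 : ℕ) : ℝ) * ∑ i ∈ Finset.range (n₀ + 1), ρ (τ i) ≤ ε / 2 := by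
      rw [one_div_mul_eq_div, div_le_iff₀ (by positivity)]
      linarith
    linarith
  have hnull : ∀ k : ℕ, volume {x | x ∈ Set.Icc (0 : ℝ) 1 ∧ 1 / ((k : ℝ) + 1) ≤ ρ x} = 0 := by
    intro k
    have hk : (0 : ℝ) < 1 / ((k : ℝ) + 1) := by positivity
    refine le_antisymm (ENNReal.le_of_forall_pos_le_add fun ε hε _ => ?_) bot_le
    rw [zero_add]
    have hε' : (0 : ℝ) < ε := hε
    obtain ⟨n₀, h₀⟩ := hI (ε * (1 / ((k : ℝ) + 1))) (by positivity)
    have h₁ := h₀ (n₀ + 1) (Nat.le_succ _)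
    have hn : 0 < n₀ + 1 := Nat.succ_pos _
    generalize n₀ + 1 = n at h₁ hn
    have hn' : (0 : ℝ) < n := by exact_mod_cast hn
    classical
    let good : ℕ → Prop := fun i =>
      ∃ x ∈ Set.Icc ((i : ℝ) * (1 / n)) ((i + 1) * (1 / n)), 1 / ((k : ℝ) + 1) ≤ ρ x
    let τ : ℕ → ℝ := fun i => if h : good i then h.choose else i * (1 / n)
    have hτ : ∀ i < n, τ i ∈ Set.Icc ((i : ℝ) * (1 / n)) ((i + 1) * (1 / n)) := by
      intro i _
      by_cases h : good i
      · simp only [τ, h, dif_pos]; exact h.choose_spec.1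
      · simp only [τ, h, dif_neg, not_false_iff]
        exact ⟨le_rfl, by have : 0 < 1 / (n : ℝ) := by positivity
                          nlinarith⟩
    have hlt := (abs_lt.1 (h₁ τ hτ)).2
    set G := (Finset.range n).filter good with hG
    have hsum : (G.card : ℝ) * (1 / ((k : ℝ) + 1)) ≤ ∑ i ∈ Finset.range n, ρ (τ i) := by
      rw [← nsmul_eq_mul, ← Finset.sum_const]
      refine (Finset.sum_le_sum fun i hi => ?_).trans
        (Finset.sum_le_sum_of_subset_of_nonneg (Finset.filter_subset good _) fun i hi _ =>
          (hpos _ (hcell (Finset.mem_range.1 hi) _ (hτ i (Finset.mem_range.1 hi)))).le)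
      have h := (Finset.mem_filter.1 hi).2
      simp only [τ, h, dif_pos]
      exact h.choose_spec.2
    have hcard : (G.card : ℝ) * (1 / n) ≤ ε := by
      have h2 : 1 / (n : ℝ) * ((G.card : ℝ) * (1 / ((k : ℝ) + 1))) ≤ ε * (1 / ((k : ℝ) + 1)) := by
        have := mul_le_mul_of_nonneg_left hsum (by positivity : 0 ≤ 1 / (n : ℝ))
        linarith
      refine le_of_mul_le_mul_right ?_ hk
      linarith
    have hcover : {x | x ∈ Set.Icc (0 : ℝ) 1 ∧ 1 / ((k : ℝ) + 1) ≤ ρ x} ⊆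
        ⋃ i ∈ G, Set.Icc ((i : ℝ) * (1 / n)) ((i + 1) * (1 / n)) := by
      rintro x ⟨hx, hxk⟩
      obtain ⟨i, hi, hxi⟩ := exists_mem_cell one_pos hx hn
      simp only [sub_zero, zero_add] at hxi
      simp only [Set.mem_iUnion]
      exact ⟨i, Finset.mem_filter.2 ⟨Finset.mem_range.2 hi, x, hxi, hxk⟩, hxi⟩
    calc volume {x | x ∈ Set.Icc (0 : ℝ) 1 ∧ 1 / ((k : ℝ) + 1) ≤ ρ x}
        ≤ ∑ i ∈ G, volume (Set.Icc ((i : ℝ) * (1 / n)) ((i + 1) * (1 / n))) :=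
          (measure_mono hcover).trans (measure_biUnion_finset_le _ _)
      _ = ENNReal.ofReal ((G.card : ℝ) * (1 / n)) := by
          rw [ENNReal.ofReal_mul (by positivity), ENNReal.ofReal_natCast, ← nsmul_eq_mul,
            ← Finset.sum_const]
          refine Finset.sum_congr rfl fun i _ => ?_
          rw [Real.volume_Icc]
          congr 1
          ring
      _ ≤ ε := by
          rw [← ENNReal.ofReal_coe_nnreal]
          exact ENNReal.ofReal_le_ofReal hcard
  have hcov : Set.Icc (0 : ℝ) 1 ⊆
      ⋃ k : ℕ, {x | x ∈ Set.Icc (0 : ℝ) 1 ∧ 1 / ((k : ℝ) + 1) ≤ ρ x} := by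
    intro x hx
    obtain ⟨k, hk⟩ := exists_nat_one_div_lt (hpos x hx)
    exact Set.mem_iUnion.2 ⟨k, hx, hk.le⟩
  have h0 := measure_mono_null hcov (measure_iUnion_null hnull)
  simp at h0

/-! ### Discrete orthogonal polynomials and the filter weights -/

/-- The `d`-th finite difference of a polynomial of degree `d` is its leading coefficient times
`d! h ^ d`, whence a lower bound for its values at `d + 1` equally spaced points. -/
lemma sq_leadingCoeff_mul_le (f : ℝ[X]) (x : ℝ) {h : ℝ} (hh : h ≠ 0) :
    (f.leadingCoeff * h ^ f.natDegree * (f.natDegree).factorial) ^ 2 ≤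
      (∑ k ∈ Finset.range (f.natDegree + 1), ((f.natDegree.choose k : ℝ)) ^ 2) *
        ∑ k ∈ Finset.range (f.natDegree + 1), f.eval (x + k * h) ^ 2 := by
  set g : ℝ[X] := f.comp (Polynomial.C h * Polynomial.X + Polynomial.C x) with hg
  have hlin : (Polynomial.C h * Polynomial.X + Polynomial.C x).natDegree = 1 :=
    Polynomial.natDegree_linear hh
  have hdeg : g.natDegree = f.natDegree := by
    rw [hg, Polynomial.natDegree_comp, hlin, mul_one]
  have hlead : g.leadingCoeff = f.leadingCoeff * h ^ f.natDegree := by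
    rw [hg, Polynomial.leadingCoeff_comp (by rw [hlin]; exact one_ne_zero),
      Polynomial.leadingCoeff_linear hh]
  have h1 := congrFun (Polynomial.fwdDiff_iter_degree_eq_factorial g) 0
  rw [fwdDiff_iter_eq_sum_shift, hdeg, hlead] at h1
  have h2 : f.leadingCoeff * h ^ f.natDegree * (f.natDegree).factorial =
      ∑ k ∈ Finset.range (f.natDegree + 1),
        ((-1 : ℝ) ^ (f.natDegree - k) * f.natDegree.choose k) * f.eval (x + k * h) := by
    have h3 : f.leadingCoeff * h ^ f.natDegree * (f.natDegree).factorial =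
      ((f.leadingCoeff * h ^ f.natDegree) • ((f.natDegree.factorial : ℕ) : ℝ → ℝ)) 0 := by
      rw [Pi.smul_apply, smul_eq_mul]
      rfl
    rw [h3, ← h1]
    refine Finset.sum_congr rfl fun k _ => ?_
    have : g.eval (0 + k • (1 : ℝ)) = f.eval (x + k * h) := by
      rw [hg, Polynomial.eval_comp]
      congr 1
      simp only [Polynomial.eval_add, Polynomial.eval_mul, Polynomial.eval_C, Polynomial.eval_X,
        nsmul_eq_mul]
      ring
    rw [this, zsmul_eq_mul]
    push_cast
    ring
  rw [h2]
  refine (Finset.sum_mul_sq_le_sq_mul_sq _ _ _).trans_eq ?_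
  congr 1
  refine Finset.sum_congr rfl fun k _ => ?_
  rw [mul_pow, ← pow_mul, mul_comm _ 2, pow_mul]
  simp

lemma sum_range_mul_eq (g : ℕ → ℝ) (r K : ℕ) :
    ∑ i ∈ Finset.range (r * K), g i = ∑ x ∈ Finset.range r, ∑ k ∈ Finset.range K, g (x + k * r) := by
  induction K with
  | zero => simp
  | succ K ih =>
    simp only [Finset.sum_range_succ, Finset.sum_add_distrib]
    rw [Nat.mul_succ, Finset.sum_range_add, ih]
    congr 1
    exact Finset.sum_congr rfl fun x _ => by congr 1; ring

lemma le_one_div_mul_of_mul_le {a b N : ℝ} (hN : 0 < N) (h : N * a ≤ b) : a ≤ 1 / N * b := by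
  rw [one_div_mul_eq_div, le_div_iff₀ hN]
  linarith

/-- Uniformly in large `N`, the squared discrete norm of a polynomial of degree `d` dominates the
square of its leading coefficient. -/
theorem exists_leadingCoeff_sq_le_discreteInner {ρ : ℝ → ℝ}
    (hpos : ∀ x ∈ Set.Icc (0 : ℝ) 1, 0 < ρ x) (hρ : RiemannIntegrable ρ 0 1) (d : ℕ) :
    ∃ c > 0, ∀ᶠ N : ℕ in atTop, ∀ f : ℝ[X], f.natDegree = d →
      c * f.leadingCoeff ^ 2 ≤ discreteInner ρ N f f := by
  obtain ⟨κ, hκ, u, v, hu, huv, hv, hle⟩ := hρ.exists_subinterval_le hpos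
  have hvu : 0 < v - u := sub_pos.2 huv
  set β : ℝ := (v - u) / (2 * (d + 1)) with hβ
  have hβ0 : 0 < β := by positivity
  set S : ℝ := ∑ k ∈ Finset.range (d + 1), ((d.choose k : ℝ)) ^ 2 with hS
  have hS0 : 0 < S := by
    refine Finset.sum_pos (fun k hk => ?_) ⟨0, by simp⟩
    have := Nat.choose_pos (Nat.lt_succ_iff.1 (Finset.mem_range.1 hk))
    positivity
  refine ⟨κ * β * ((β ^ d * d.factorial) ^ 2 / S), by positivity, ?_⟩
  filter_upwards [eventually_ge_atTop (⌈(d + 1 : ℝ) / (v - u)⌉₊ + 1)] with N hN f hf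
  have hN0 : 0 < N := by omega
  have hN0' : (0 : ℝ) < N := by exact_mod_cast hN0
  have hNvu : (d + 1 : ℝ) ≤ N * (v - u) := by
    rw [← div_le_iff₀ hvu]
    exact (Nat.le_ceil _).trans (Nat.cast_le.2 (by omega))
  -- the blocks of length `r` that follow the index `⌊N u⌋ + 1` lie over `[u, v]`
  set r : ℕ := ⌊N * (v - u) / (d + 1)⌋₊ with hr
  have hd1 : (0 : ℝ) < d + 1 := by positivity
  have hr1 : (r : ℝ) * (d + 1) ≤ N * (v - u) := by
    rw [← le_div_iff₀ hd1]
    exact Nat.floor_le (by positivity)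
  have hr2 : N * β ≤ r := by
    have h1 : 1 ≤ N * (v - u) / (d + 1) := by rwa [le_div_iff₀ hd1, one_mul]
    have h2 := Nat.lt_floor_add_one (N * (v - u) / (d + 1 : ℝ))
    have h3 : (1 : ℝ) ≤ r := by
      exact Nat.one_le_cast.2 (Nat.le_floor (by rw [Nat.cast_one]; exact h1))
    have h4 : N * β = (N * (v - u) / (d + 1)) / 2 := by rw [hβ]; field_simp
    rw [h4]
    linarith
  have hr0 : (0 : ℝ) < r := lt_of_lt_of_le (by positivity) hr2
  set j₀ : ℕ := ⌊N * u⌋₊ + 1 with hj₀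
  have hj₁ : N * u ≤ j₀ := by rw [hj₀]; push_cast; exact (Nat.lt_floor_add_one _).le
  have hj₂ : (j₀ : ℝ) ≤ N * u + 1 := by
    rw [hj₀]; push_cast
    linarith [Nat.floor_le (show 0 ≤ N * u by positivity)]
  have hmem : ∀ i < r * (d + 1), ((j₀ + i : ℕ) : ℝ) / N ∈ Set.Icc u v := by
    intro i hi
    have hi' : (i : ℝ) + 1 ≤ r * (d + 1) := by exact_mod_cast hi
    have hi0 : (0 : ℝ) ≤ i := by positivity
    push_cast
    constructor
    · rw [le_div_iff₀ hN0']; nlinarith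
    · rw [div_le_iff₀ hN0']; nlinarith
  have hsub : Finset.Ico j₀ (j₀ + r * (d + 1)) ⊆ Finset.Icc 1 N := by
    intro j hj
    obtain ⟨h1, h2⟩ := Finset.mem_Ico.1 hj
    refine Finset.mem_Icc.2 ⟨by omega, ?_⟩
    have h3 := (hmem (j - j₀) (by omega)).2.trans hv
    rw [div_le_one hN0', Nat.add_sub_cancel' h1] at h3
    exact_mod_cast h3
  have hblock : ∀ x < r, (f.leadingCoeff * (β ^ d * d.factorial)) ^ 2 / S ≤
      ∑ k ∈ Finset.range (d + 1), f.eval (((j₀ + (x + k * r) : ℕ) : ℝ) / N) ^ 2 := by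
    intro x _
    have h1 := sq_leadingCoeff_mul_le f (((j₀ + x : ℕ) : ℝ) / N) (h := r / N) (by positivity)
    rw [hf, ← hS] at h1
    rw [div_le_iff₀ hS0, mul_comm _ S]
    have hrN : β ≤ r / N := by rw [le_div_iff₀ hN0']; linarith
    refine le_trans ?_ (h1.trans_eq ?_)
    · rw [mul_assoc, mul_pow f.leadingCoeff, mul_pow f.leadingCoeff]
      refine mul_le_mul_of_nonneg_left (pow_le_pow_left₀ (mul_nonneg (pow_nonneg hβ0.le d) (Nat.cast_nonneg _)) ?_ 2) (sq_nonneg _)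
      exact mul_le_mul_of_nonneg_right (pow_le_pow_left₀ hβ0.le hrN d) (by positivity)
    · congr 1
      refine Finset.sum_congr rfl fun k _ => ?_
      congr 2
      push_cast
      ring
  unfold discreteInner
  refine le_one_div_mul_of_mul_le hN0' ?_
  calc (N : ℝ) * (κ * β * ((β ^ d * d.factorial) ^ 2 / S) * f.leadingCoeff ^ 2)
      = (N * β) * (κ * ((f.leadingCoeff * (β ^ d * d.factorial)) ^ 2 / S)) := by ring
    _ ≤ r * (κ * ((f.leadingCoeff * (β ^ d * d.factorial)) ^ 2 / S)) :=
        mul_le_mul_of_nonneg_right hr2 (by positivity)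
    _ = κ * ∑ x ∈ Finset.range r, (f.leadingCoeff * (β ^ d * d.factorial)) ^ 2 / S := by
        rw [Finset.sum_const, Finset.card_range, nsmul_eq_mul]; ring
    _ ≤ κ * ∑ x ∈ Finset.range r, ∑ k ∈ Finset.range (d + 1),
          f.eval (((j₀ + (x + k * r) : ℕ) : ℝ) / N) ^ 2 :=
        mul_le_mul_of_nonneg_left
          (Finset.sum_le_sum fun x hx => hblock x (Finset.mem_range.1 hx)) hκ.le
    _ = ∑ i ∈ Finset.range (r * (d + 1)), κ * f.eval (((j₀ + i : ℕ) : ℝ) / N) ^ 2 := by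
        rw [← sum_range_mul_eq (fun i => f.eval (((j₀ + i : ℕ) : ℝ) / N) ^ 2), Finset.mul_sum]
    _ ≤ ∑ i ∈ Finset.range (r * (d + 1)), ρ (((j₀ + i : ℕ) : ℝ) / N) *
          f.eval (((j₀ + i : ℕ) : ℝ) / N) * f.eval (((j₀ + i : ℕ) : ℝ) / N) := by
        refine Finset.sum_le_sum fun i hi => ?_
        rw [mul_assoc, ← sq]
        exact mul_le_mul_of_nonneg_right (hle _ (hmem i (Finset.mem_range.1 hi))) (sq_nonneg _)
    _ = ∑ j ∈ Finset.Ico j₀ (j₀ + r * (d + 1)),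
          ρ ((j : ℝ) / N) * f.eval ((j : ℝ) / N) * f.eval ((j : ℝ) / N) := by
        rw [Finset.sum_Ico_eq_sum_range, Nat.add_sub_cancel_left]
    _ ≤ _ := by
        refine Finset.sum_le_sum_of_subset_of_nonneg hsub fun j hj _ => ?_
        rw [mul_assoc, ← sq]
        obtain ⟨_, h2⟩ := Finset.mem_Icc.1 hj
        refine mul_nonneg (hpos _ ⟨by positivity, ?_⟩).le (sq_nonneg _)
        rw [div_le_one hN0']
        exact_mod_cast h2

lemma discreteInner_add_right (ρ : ℝ → ℝ) (N : ℕ) (f g h : ℝ[X]) :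
    discreteInner ρ N f (g + h) = discreteInner ρ N f g + discreteInner ρ N f h := by
  simp only [discreteInner, Polynomial.eval_add, mul_add, Finset.sum_add_distrib]

lemma discreteInner_C_mul_right (ρ : ℝ → ℝ) (N : ℕ) (f g : ℝ[X]) (c : ℝ) :
    discreteInner ρ N f (Polynomial.C c * g) = c * discreteInner ρ N f g := by
  simp only [discreteInner, Polynomial.eval_mul, Polynomial.eval_C, Finset.mul_sum]
  exact Finset.sum_congr rfl fun j _ => by ring

namespace IsOrthogonalFamily

variable {ρ : ℝ → ℝ} {N : ℕ} {q : ℕ → ℝ[X]}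

lemma natDegree_eq (hq : IsOrthogonalFamily ρ N q) {d : ℕ} (hd : d < N) :
    (q d).natDegree = d :=
  Polynomial.natDegree_eq_of_degree_eq_some (hq.degree_eq d hd)

lemma leadingCoeff_ne_zero (hq : IsOrthogonalFamily ρ N q) {d : ℕ} (hd : d < N) :
    (q d).leadingCoeff ≠ 0 := by
  rw [Ne, Polynomial.leadingCoeff_eq_zero]
  intro h
  have := hq.degree_eq d hd
  rw [h, Polynomial.degree_zero] at this
  exact absurd this (by simp)

/-- `f` minus a multiple of a polynomial of the same degree has lower degree. -/
lemma degree_sub_lt {d : ℕ} {f g : ℝ[X]} (hg : g.natDegree = d) (hg0 : g.leadingCoeff ≠ 0)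
    (hf : f.degree < (d + 1 : ℕ)) :
    (f - Polynomial.C (f.coeff d / g.leadingCoeff) * g).degree < d := by
  rw [Polynomial.degree_lt_iff_coeff_zero] at hf ⊢
  intro i hi
  rw [Polynomial.coeff_sub, Polynomial.coeff_C_mul]
  rcases eq_or_lt_of_le hi with rfl | hi
  · have : g.coeff d = g.leadingCoeff := by rw [Polynomial.leadingCoeff, hg]
    rw [this, div_mul_cancel₀ _ hg0, sub_self]
  · rw [hf i hi, Polynomial.coeff_eq_zero_of_natDegree_lt (p := g) (by omega)]
    simp

theorem discreteInner_eq_zero (hq : IsOrthogonalFamily ρ N q) {d : ℕ} (hd : d < N)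
    {f : ℝ[X]} (hf : f.degree < d) : discreteInner ρ N (q d) f = 0 := by
  have key : ∀ e ≤ d, ∀ f : ℝ[X], f.degree < e → discreteInner ρ N (q d) f = 0 := by
    intro e
    induction e with
    | zero =>
      intro _ f hf
      have : f = 0 := by
        rw [← Polynomial.degree_eq_bot]
        simpa [Nat.WithBot.lt_zero_iff] using hf
      simp [this, discreteInner]
    | succ e ih =>
      intro he f hf
      have h1 := ih (by omega) _
        (degree_sub_lt (hq.natDegree_eq (by omega)) (hq.leadingCoeff_ne_zero (by omega)) hf)
      rw [← sub_add_cancel f (Polynomial.C (f.coeff e / (q e).leadingCoeff) * q e),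
        discreteInner_add_right, h1, discreteInner_C_mul_right,
        hq.orthogonal d hd e (by omega) (by omega), mul_zero, zero_add]
  exact key d le_rfl f hf

theorem discreteInner_self (hq : IsOrthogonalFamily ρ N q) {d : ℕ} (hd : d < N) :
    discreteInner ρ N (q d) (q d) =
      (q d).leadingCoeff * discreteInner ρ N (q d) (Polynomial.X ^ d) := by
  have hX : (Polynomial.X ^ d : ℝ[X]).leadingCoeff = 1 := by simp
  have h1 := hq.discreteInner_eq_zero hd (degree_sub_lt (f := q d) (g := Polynomial.X ^ d)
    (by simp) (by rw [hX]; exact one_ne_zero)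
    (by rw [hq.degree_eq d hd]; exact_mod_cast Nat.lt_succ_self d))
  have h2 : (q d).coeff d = (q d).leadingCoeff := by
    rw [Polynomial.leadingCoeff, hq.natDegree_eq hd]
  rw [hX, div_one, h2, sub_eq_add_neg, ← neg_mul, ← Polynomial.C_neg, discreteInner_add_right,
    discreteInner_C_mul_right] at h1
  linarith

end IsOrthogonalFamily

/-- The coefficient of the `j`-th sample of a window in `filterEstimate`. -/
noncomputable def filterWeight (ρ : ℝ → ℝ) (q : ℕ → ℝ[X]) (T : ℝ) (n N d j : ℕ) : ℝ :=
  (d.factorial * (n : ℝ) ^ d) /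
      ((N : ℝ) ^ (d + 1) * T ^ d * discreteInner ρ N (q d) (Polynomial.X ^ d)) *
    (ρ (j / N) * (q d).eval ((j : ℝ) / N))

lemma filterEstimate_eq_sum (ρ : ℝ → ℝ) (q : ℕ → ℝ[X]) (T : ℝ) (n N : ℕ) (z : ℕ → ℝ) (k d : ℕ) :
    filterEstimate ρ q T n N z k d =
      ∑ j ∈ Finset.Icc 1 N, filterWeight ρ q T n N d j * z (k + j) := by
  rw [filterEstimate, Finset.mul_sum]
  exact Finset.sum_congr rfl fun j _ => by rw [filterWeight]; ring

lemma sum_filterWeight_mul_pow (ρ : ℝ → ℝ) (q : ℕ → ℝ[X]) (T : ℝ) {n N : ℕ} (hN : N ≠ 0)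
    (d k : ℕ) :
    ∑ j ∈ Finset.Icc 1 N, filterWeight ρ q T n N d j * ((j : ℝ) * T / n) ^ k =
      (d.factorial * (n : ℝ) ^ d) /
        ((N : ℝ) ^ (d + 1) * T ^ d * discreteInner ρ N (q d) (Polynomial.X ^ d)) *
        ((N * T / n) ^ k * (N * discreteInner ρ N (q d) (Polynomial.X ^ k))) := by
  have hN' : (N : ℝ) ≠ 0 := by exact_mod_cast hN
  simp only [filterWeight, mul_assoc]
  rw [← Finset.mul_sum]
  congr 1
  rw [discreteInner, ← mul_assoc (N : ℝ), mul_one_div_cancel hN', one_mul, Finset.mul_sum]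
  refine Finset.sum_congr rfl fun j _ => ?_
  rw [Polynomial.eval_pow, Polynomial.eval_X]
  have : (j : ℝ) * (T / n) = (N * (T / n)) * (j / N) := by field_simp
  simp only [← mul_div_assoc] at this ⊢
  rw [this]
  simp only [mul_div_assoc, mul_pow]
  ring

/-- For large windows the filter weights reproduce the `d`-th derivative of polynomials of degree at
most `d` exactly, and the sum of their squares has order `(n / N) ^ (2 d) / N`. -/
theorem exists_filterWeight_bound {ρ : ℝ → ℝ} (hpos : ∀ x ∈ Set.Icc (0 : ℝ) 1, 0 < ρ x)
    (hρ : RiemannIntegrable ρ 0 1) {T : ℝ} (hT : 0 < T) (d : ℕ) :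
    ∃ B > 0, ∀ᶠ N : ℕ in atTop, 0 < N ∧ ∀ q : ℕ → ℝ[X], IsOrthogonalFamily ρ N q → ∀ n : ℕ, 0 < n →
      (∀ k < d, ∑ j ∈ Finset.Icc 1 N, filterWeight ρ q T n N d j * ((j : ℝ) * T / n) ^ k = 0) ∧
      ∑ j ∈ Finset.Icc 1 N, filterWeight ρ q T n N d j * ((j : ℝ) * T / n) ^ d = d.factorial ∧
      ∑ j ∈ Finset.Icc 1 N, filterWeight ρ q T n N d j ^ 2 ≤ B * ((n / N : ℝ) ^ (2 * d) / N) := by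
  obtain ⟨c, hc, hlow⟩ := exists_leadingCoeff_sq_le_discreteInner hpos hρ d
  obtain ⟨M, hM, hbound⟩ := hρ.exists_bound one_pos
  refine ⟨(d.factorial : ℝ) ^ 2 * (M + 1) / (c * T ^ (2 * d)), by positivity, ?_⟩
  filter_upwards [hlow, eventually_gt_atTop d] with N hN hdN
  refine ⟨by omega, fun q hq n hn => ?_⟩
  have hN0 : N ≠ 0 := by omega
  have hN' : (0 : ℝ) < N := by exact_mod_cast (by omega : 0 < N)
  have hn' : (0 : ℝ) < n := by exact_mod_cast hn
  have hl := hq.leadingCoeff_ne_zero hdN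
  have hself := hq.discreteInner_self hdN
  have hcl := hN (q d) (hq.natDegree_eq hdN)
  rw [hself] at hcl
  set l := (q d).leadingCoeff
  set h := discreteInner ρ N (q d) (Polynomial.X ^ d) with hh
  have hlh : 0 < l * h := lt_of_lt_of_le (by positivity) hcl
  have hh0 : h ≠ 0 := right_ne_zero_of_mul hlh.ne'
  refine ⟨fun k hk => ?_, ?_, ?_⟩
  · rw [sum_filterWeight_mul_pow ρ q T hN0, hq.discreteInner_eq_zero hdN (f := Polynomial.X ^ k)]
    · simp
    · rw [Polynomial.degree_X_pow]; exact_mod_cast hk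
  · rw [sum_filterWeight_mul_pow ρ q T hN0, ← hh, div_pow, mul_pow]
    field_simp
    ring
  · have hsum : ∑ j ∈ Finset.Icc 1 N, (ρ (j / N) * (q d).eval ((j : ℝ) / N)) ^ 2 ≤
        (M + 1) * (N * (l * h)) := by
      rw [← hself, discreteInner, ← mul_assoc (N : ℝ), mul_one_div_cancel hN'.ne', one_mul,
        Finset.mul_sum]
      refine Finset.sum_le_sum fun j hj => ?_
      have hj1 : ((j : ℝ) / N) ∈ Set.Icc (0 : ℝ) 1 := by
        refine ⟨by positivity, ?_⟩
        rw [div_le_one hN']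
        exact_mod_cast (Finset.mem_Icc.1 hj).2
      have h1 := hpos _ hj1
      have h2 := (le_abs_self _).trans (hbound _ hj1)
      have h3 : 0 ≤ ρ (j / N) * (q d).eval ((j : ℝ) / N) ^ 2 := by positivity
      nlinarith
    have hlh' : l / h ≤ 1 / c := by
      have : l / h = l ^ 2 / (l * h) := by field_simp
      rw [this, div_le_div_iff₀ hlh hc]
      linarith
    simp only [filterWeight, mul_pow _ (_ * _) 2]
    rw [← Finset.mul_sum, ← hh]
    calc _ ≤ (d.factorial * (n : ℝ) ^ d / ((N : ℝ) ^ (d + 1) * T ^ d * h)) ^ 2 *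
          ((M + 1) * (N * (l * h))) := mul_le_mul_of_nonneg_left hsum (sq_nonneg _)
      _ = (d.factorial : ℝ) ^ 2 * (M + 1) / T ^ (2 * d) * ((n / N : ℝ) ^ (2 * d) / N) *
          (l / h) := by
        simp only [div_pow, pow_mul, mul_pow, pow_succ]
        field_simp
        rw [one_pow]
      _ ≤ (d.factorial : ℝ) ^ 2 * (M + 1) / T ^ (2 * d) * ((n / N : ℝ) ^ (2 * d) / N) *
          (1 / c) := mul_le_mul_of_nonneg_left hlh' (by positivity)
      _ = _ := by field_simp

/-! ### Mean square error of the differentiation filter -/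

/-- Taylor's formula with a crude remainder for a chain `g 0, g 1, …` of successive derivatives,
where the last one is only assumed bounded. -/
lemma abs_sub_taylor_le {T K : ℝ} (d : ℕ) (g : ℕ → ℝ → ℝ)
    (hg : ∀ k < d, ∀ t ∈ Set.Icc 0 T, HasDerivWithinAt (g k) (g (k + 1) t) (Set.Icc 0 T) t)
    (hK : ∀ t ∈ Set.Icc 0 T, |g d t| ≤ K) {t h : ℝ} (ht : 0 ≤ t) (hh : 0 ≤ h) (hth : t + h ≤ T) :
    |g 0 (t + h) - ∑ k ∈ Finset.range d, g k t / k.factorial * h ^ k| ≤ K * h ^ d := by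
  induction d generalizing g h with
  | zero => simpa using hK (t + h) ⟨by linarith, hth⟩
  | succ d ih =>
    have hK0 : 0 ≤ K := (abs_nonneg _).trans (hK (t + h) ⟨by linarith, hth⟩)
    have hI : ∀ x ∈ Set.Icc 0 h, |g 1 (t + x) -
        ∑ k ∈ Finset.range d, g (k + 1) t / k.factorial * x ^ k| ≤ K * x ^ d := fun x hx =>
      ih (fun k => g (k + 1)) (fun k hk => hg (k + 1) (by omega)) hK hx.1 (by linarith [hx.2])
    have hderiv : ∀ x ∈ Set.Icc 0 h, HasDerivWithinAt
        (fun x => g 0 (t + x) - (∑ k ∈ Finset.range d, g (k + 1) t / (k + 1).factorial * x ^ (k + 1)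
          + g 0 t))
        (g 1 (t + x) - ∑ k ∈ Finset.range d, g (k + 1) t / k.factorial * x ^ k)
        (Set.Icc 0 h) x := by
      intro x hx
      refine HasDerivWithinAt.sub ?_ ?_
      · have h1 : HasDerivWithinAt (fun x => t + x) 1 (Set.Icc 0 h) x :=
          ((hasDerivAt_id x).const_add t).hasDerivWithinAt
        have h2 := (hg 0 (by omega) (t + x) ⟨by linarith [hx.1], by linarith [hx.2]⟩).comp x h1
          (fun z hz => ⟨by linarith [hz.1], by linarith [hz.2]⟩)
        simpa [Function.comp_def] using h2
      · refine HasDerivWithinAt.add_const _ (HasDerivWithinAt.fun_sum fun k _ => ?_)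
        have h1 := ((hasDerivAt_pow (k + 1) x).const_mul
          (g (k + 1) t / (k + 1).factorial)).hasDerivWithinAt (s := Set.Icc 0 h)
        convert! h1 using 1
        rw [Nat.factorial_succ, Nat.add_sub_cancel]
        have : (k.factorial : ℝ) ≠ 0 := by exact_mod_cast k.factorial_ne_zero
        push_cast
        field_simp
    have hmv := norm_image_sub_le_of_norm_deriv_le_segment' hderiv (C := K * h ^ d)
      (fun x hx => (hI x ⟨hx.1, hx.2.le⟩).trans
        (mul_le_mul_of_nonneg_left (pow_le_pow_left₀ hx.1 hx.2.le d) hK0)) h ⟨hh, le_rfl⟩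
    rw [Finset.sum_range_succ']
    simpa [pow_succ, mul_assoc] using hmv

namespace IsTrajectory

variable {m p : ℕ} {φ : EuclideanSpace ℝ (Fin m) → EuclideanSpace ℝ (Fin p)}
  {θ : EuclideanSpace ℝ (Fin p)} {T : ℝ} {y : ℝ → ℝ}

lemma hasDerivWithinAt (hy : IsTrajectory φ θ T y) {d : ℕ} (hd : d ≤ m) {t : ℝ}
    (ht : t ∈ Set.Icc 0 T) :
    HasDerivWithinAt (timeDeriv T y d) (timeDeriv T y (d + 1) t) (Set.Icc 0 T) t := by
  have := (hy.differentiable d hd t ht).hasDerivWithinAt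
  rwa [show derivWithin (timeDeriv T y d) (Set.Icc 0 T) t = timeDeriv T y (d + 1) t from
    (congrFun iteratedDerivWithin_succ t).symm] at this

lemma exists_abs_timeDeriv_le (hy : IsTrajectory φ θ T y) (hT : 0 < T) {d : ℕ} (hd : d ≤ m + 1) :
    ∃ K, 0 ≤ K ∧ ∀ t ∈ Set.Icc 0 T, |timeDeriv T y d t| ≤ K := by
  rcases eq_or_lt_of_le hd with rfl | hd
  · exact hy.integrable.exists_bound hT
  · obtain ⟨K, hK⟩ := isCompact_Icc.exists_bound_of_continuousOn
      (hy.differentiable d (by omega)).continuousOn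
    exact ⟨K, (norm_nonneg _).trans (hK 0 ⟨le_rfl, hT.le⟩), hK⟩

end IsTrajectory

namespace IsNoise

variable {Ω : Type*} [MeasurableSpace Ω] {P : Measure Ω} {T : ℝ} {w : ℝ → Ω → ℝ}

lemma memLp_sum (hw : IsNoise P T w) (s : Finset ℕ) (W : ℕ → ℝ) {τ : ℕ → ℝ}
    (hτ : ∀ j ∈ s, τ j ∈ Set.Icc 0 T) :
    MemLp (fun ω => ∑ j ∈ s, W j * w (τ j) ω) 2 P :=
  memLp_finsetSum s fun j hj => (hw.memLp _ (hτ j hj)).const_mul (W j)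

/-- The variance of a linear combination of noise values at distinct times. -/
lemma integral_sum_sq (hw : IsNoise P T w) (s : Finset ℕ) (W : ℕ → ℝ) {τ : ℕ → ℝ}
    (hτ : ∀ j ∈ s, τ j ∈ Set.Icc 0 T) (hinj : Set.InjOn τ s) :
    ∫ ω, (∑ j ∈ s, W j * w (τ j) ω) ^ 2 ∂P = ∑ j ∈ s, W j ^ 2 * ∫ ω, w (τ j) ω ^ 2 ∂P := by
  have hint : ∀ i ∈ s, ∀ j ∈ s,
      Integrable (fun ω => W i * W j * (w (τ i) ω * w (τ j) ω)) P := fun i hi j hj =>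
    ((hw.memLp _ (hτ i hi)).integrable_mul (hw.memLp _ (hτ j hj))).const_mul _
  calc ∫ ω, (∑ j ∈ s, W j * w (τ j) ω) ^ 2 ∂P
      = ∫ ω, ∑ i ∈ s, ∑ j ∈ s, W i * W j * (w (τ i) ω * w (τ j) ω) ∂P := by
        refine integral_congr_ae (Eventually.of_forall fun ω => ?_)
        simp only [sq, Finset.sum_mul_sum]
        exact Finset.sum_congr rfl fun i _ => Finset.sum_congr rfl fun j _ => by ring
    _ = ∑ i ∈ s, ∑ j ∈ s, W i * W j * ∫ ω, w (τ i) ω * w (τ j) ω ∂P := by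
        rw [integral_finsetSum _ fun i hi => integrable_finsetSum _ fun j hj => hint i hi j hj]
        refine Finset.sum_congr rfl fun i hi => ?_
        rw [integral_finsetSum _ fun j hj => hint i hi j hj]
        exact Finset.sum_congr rfl fun j _ => integral_const_mul _ _
    _ = _ := by
        refine Finset.sum_congr rfl fun i hi => ?_
        rw [Finset.sum_eq_single_of_mem i hi fun j hj hji => ?_]
        · simp only [sq]
        · rw [hw.uncorrelated _ (hτ i hi) _ (hτ j hj) fun h => hji (hinj hj hi h.symm), mul_zero]

end IsNoise

/-- The mean square error of the filter on any window of `N` samples, uniformly over the windows: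
the bias has order `N / n` and the variance has order `(n / N) ^ (2 d) / N`. -/
theorem exists_filterEstimate_bound {m p : ℕ}
    {φ : EuclideanSpace ℝ (Fin m) → EuclideanSpace ℝ (Fin p)} {θ : EuclideanSpace ℝ (Fin p)}
    {T : ℝ} (hT : 0 < T) {y : ℝ → ℝ} (hy : IsTrajectory φ θ T y)
    {Ω : Type*} [MeasurableSpace Ω] {P : Measure Ω} [IsProbabilityMeasure P]
    {w : ℝ → Ω → ℝ} (hw : IsNoise P T w)
    {ρ : ℝ → ℝ} (hpos : ∀ x ∈ Set.Icc (0 : ℝ) 1, 0 < ρ x) (hρ : RiemannIntegrable ρ 0 1)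
    {d : ℕ} (hd : d ≤ m) :
    ∃ C > 0, ∀ᶠ N : ℕ in atTop, ∀ q : ℕ → ℝ[X], IsOrthogonalFamily ρ N q →
      ∀ n : ℕ, 0 < n → ∀ k : ℕ, k + N ≤ n →
        MemLp (fun ω => filterEstimate ρ q T n N (sample T y w n ω) k d -
          timeDeriv T y d (k * T / n)) 2 P ∧
        ∫ ω, (filterEstimate ρ q T n N (sample T y w n ω) k d -
          timeDeriv T y d (k * T / n)) ^ 2 ∂P ≤
            C * ((N / n : ℝ) ^ 2 + (n / N : ℝ) ^ (2 * d) / N) := by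
  obtain ⟨K, hK0, hK⟩ := hy.exists_abs_timeDeriv_le hT (d := d + 1) (by omega)
  obtain ⟨V, hV0, hV⟩ := hw.integrable.exists_bound hT
  obtain ⟨B, hB, hfilter⟩ := exists_filterWeight_bound hpos hρ hT d
  refine ⟨2 * B * K ^ 2 * T ^ (2 * d + 2) + 2 * B * V + 1, by positivity, ?_⟩
  filter_upwards [hfilter] with N hN q hq n hn k hkN
  obtain ⟨hN0, hN⟩ := hN
  obtain ⟨hlow, htop, hsq⟩ := hN q hq n hn
  have hn' : (0 : ℝ) < n := by exact_mod_cast hn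
  have hN' : (0 : ℝ) < N := by exact_mod_cast hN0
  set W : ℕ → ℝ := filterWeight ρ q T n N d with hW
  set t : ℝ := k * T / n with ht
  have ht0 : 0 ≤ t := by positivity
  let τ : ℕ → ℝ := fun j => ((k + j : ℕ) : ℝ) * T / n
  have hτt : ∀ j, τ j = t + (j : ℝ) * T / n := by
    intro j; simp only [τ, ht]; push_cast; ring
  have hτ : ∀ j ∈ Finset.Icc 1 N, τ j ∈ Set.Icc 0 T := by
    intro j hj
    have h1 : ((k + j : ℕ) : ℝ) ≤ n := by
      exact_mod_cast (show k + j ≤ n by have := (Finset.mem_Icc.1 hj).2; omega)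
    refine ⟨by positivity, ?_⟩
    rw [div_le_iff₀ hn', mul_comm T]
    exact mul_le_mul_of_nonneg_right h1 hT.le
  have hinj : Set.InjOn τ (Finset.Icc 1 N : Finset ℕ) := by
    intro i _ j _ hij
    simp only [τ] at hij
    rw [div_left_inj' hn'.ne', mul_left_inj' hT.ne', Nat.cast_inj] at hij
    omega
  set R : ℕ → ℝ := fun j => y (τ j) -
    ∑ l ∈ Finset.range (d + 1), timeDeriv T y l t / l.factorial * ((j : ℝ) * T / n) ^ l with hR
  have hRle : ∀ j ∈ Finset.Icc 1 N, R j ^ 2 ≤ (K * (N * T / n) ^ (d + 1)) ^ 2 := by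
    intro j hj
    have hjN : (j : ℝ) ≤ N := by exact_mod_cast (Finset.mem_Icc.1 hj).2
    have h1 := abs_sub_taylor_le (d + 1) (timeDeriv T y)
      (fun l hl t ht => hy.hasDerivWithinAt (by omega) ht) hK ht0
      (h := (j : ℝ) * T / n) (by positivity) (by rw [← hτt]; exact (hτ j hj).2)
    rw [← hτt] at h1
    have h2 : timeDeriv T y 0 = y := by funext x; simp [timeDeriv]
    rw [h2] at h1
    rw [← sq_abs (R j)]
    refine pow_le_pow_left₀ (abs_nonneg _) (h1.trans ?_) 2
    gcongr
  have hbias : ∑ j ∈ Finset.Icc 1 N, W j * y (τ j) - timeDeriv T y d t =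
      ∑ j ∈ Finset.Icc 1 N, W j * R j := by
    have h1 : ∑ j ∈ Finset.Icc 1 N, W j *
        ∑ l ∈ Finset.range (d + 1), timeDeriv T y l t / l.factorial * ((j : ℝ) * T / n) ^ l =
        timeDeriv T y d t := by
      simp only [Finset.mul_sum]
      rw [Finset.sum_comm]
      have h2 : ∀ l, ∑ j ∈ Finset.Icc 1 N,
          W j * (timeDeriv T y l t / l.factorial * ((j : ℝ) * T / n) ^ l) =
          timeDeriv T y l t / l.factorial *
            ∑ j ∈ Finset.Icc 1 N, W j * ((j : ℝ) * T / n) ^ l := by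
        intro l
        rw [Finset.mul_sum]
        exact Finset.sum_congr rfl fun j _ => by ring
      simp only [h2]
      rw [Finset.sum_range_succ, Finset.sum_eq_zero fun l hl => by
        rw [hlow l (Finset.mem_range.1 hl), mul_zero], htop, zero_add]
      exact div_mul_cancel₀ _ (by exact_mod_cast d.factorial_ne_zero)
    simp only [hR, mul_sub, Finset.sum_sub_distrib]
    rw [h1]
  have hbias_sq : (∑ j ∈ Finset.Icc 1 N, W j * R j) ^ 2 ≤
      B * K ^ 2 * T ^ (2 * d + 2) * (N / n : ℝ) ^ 2 := by
    have hR2 : ∑ j ∈ Finset.Icc 1 N, R j ^ 2 ≤ N * (K * (N * T / n) ^ (d + 1)) ^ 2 := by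
      have := Finset.sum_le_sum hRle
      simpa using this
    calc _ ≤ (∑ j ∈ Finset.Icc 1 N, W j ^ 2) * ∑ j ∈ Finset.Icc 1 N, R j ^ 2 :=
          Finset.sum_mul_sq_le_sq_mul_sq _ _ _
      _ ≤ (B * ((n / N : ℝ) ^ (2 * d) / N)) * (N * (K * (N * T / n) ^ (d + 1)) ^ 2) :=
          mul_le_mul hsq hR2 (Finset.sum_nonneg fun j _ => sq_nonneg _) (by positivity)
      _ = _ := by
          simp only [div_pow, mul_pow, pow_add, pow_mul]
          field_simp
          ring
  have hdecomp : ∀ ω, filterEstimate ρ q T n N (sample T y w n ω) k d - timeDeriv T y d t =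
      ∑ j ∈ Finset.Icc 1 N, W j * R j + ∑ j ∈ Finset.Icc 1 N, W j * w (τ j) ω := by
    intro ω
    rw [filterEstimate_eq_sum, ← hbias]
    simp only [sample, mul_add, Finset.sum_add_distrib]
    ring
  have hmem := hw.memLp_sum (Finset.Icc 1 N) W hτ
  have hvar : ∫ ω, (∑ j ∈ Finset.Icc 1 N, W j * w (τ j) ω) ^ 2 ∂P ≤
      B * V * ((n / N : ℝ) ^ (2 * d) / N) := by
    rw [hw.integral_sum_sq _ W hτ hinj]
    calc _ ≤ ∑ j ∈ Finset.Icc 1 N, W j ^ 2 * V := Finset.sum_le_sum fun j hj =>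
          mul_le_mul_of_nonneg_left ((le_abs_self _).trans (hV _ (hτ j hj))) (sq_nonneg _)
      _ = (∑ j ∈ Finset.Icc 1 N, W j ^ 2) * V := by rw [Finset.sum_mul]
      _ ≤ (B * ((n / N : ℝ) ^ (2 * d) / N)) * V := mul_le_mul_of_nonneg_right hsq hV0
      _ = _ := by ring
  simp only [hdecomp]
  set b := ∑ j ∈ Finset.Icc 1 N, W j * R j
  clear_value b W
  have hmem' : MemLp (fun ω => b + ∑ j ∈ Finset.Icc 1 N, W j * w (τ j) ω) 2 P :=
    MemLp.add (memLp_const b) hmem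
  refine ⟨hmem', ?_⟩
  calc ∫ ω, (b + ∑ j ∈ Finset.Icc 1 N, W j * w (τ j) ω) ^ 2 ∂P
      ≤ ∫ ω, (2 * b ^ 2 + 2 * (∑ j ∈ Finset.Icc 1 N, W j * w (τ j) ω) ^ 2) ∂P := by
        refine integral_mono hmem'.integrable_sq
          ((integrable_const _).add (hmem.integrable_sq.const_mul 2)) fun ω => ?_
        have := add_sq_le (a := b) (b := ∑ j ∈ Finset.Icc 1 N, W j * w (τ j) ω)
        simp only
        linarith
    _ = 2 * b ^ 2 + 2 * ∫ ω, (∑ j ∈ Finset.Icc 1 N, W j * w (τ j) ω) ^ 2 ∂P := by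
        rw [integral_add (integrable_const _) (hmem.integrable_sq.const_mul 2), integral_const, integral_const_mul]
        simp
    _ ≤ 2 * (B * K ^ 2 * T ^ (2 * d + 2) * (N / n : ℝ) ^ 2) +
          2 * (B * V * ((n / N : ℝ) ^ (2 * d) / N)) := by gcongr
    _ ≤ _ := by
        have h1 : 0 ≤ (N / n : ℝ) ^ 2 := by positivity
        have h2 : 0 ≤ (n / N : ℝ) ^ (2 * d) / N := by positivity
        have h3 : 0 ≤ 2 * B * V + 1 := by positivity
        have h4 : 0 ≤ 2 * B * K ^ 2 * T ^ (2 * d + 2) + 1 := by positivity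
        nlinarith [mul_nonneg h3 h1, mul_nonneg h4 h2]

/-! ### Perturbation of the ridge estimator -/

/-- The scalar inequality behind the error bound: `V = ‖θ̂ - θ‖`, `a = ‖Φ̂ (θ̂ - θ)‖`,
`e = ‖û - Φ̂ θ‖`, `t = ‖θ‖`, and `δ` bounds `‖Φ̂ - Φ‖`. Either `δ ≤ σ / 2`, and `Φ̂` inherits the
least singular value of `Φ` up to a factor `2`, or `1 ≤ 2 δ / σ`, and the regularization alone
gives a bound that this factor may multiply. -/
lemma ridge_scalar_bound {V a e t δ σ lam : ℝ} (hV : 0 ≤ V) (ha : 0 ≤ a) (he : 0 ≤ e) (ht : 0 ≤ t)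
    (hδ : 0 ≤ δ) (hσ : 0 < σ) (hlam : 0 < lam)
    (h1 : lam ^ 2 * V ^ 2 + a ^ 2 ≤ a * e + lam ^ 2 * (t * V)) (h2 : σ * V ≤ a + δ * V) :
    V ≤ 2 * e / σ + 4 * lam ^ 2 * t / σ ^ 2 + e * δ / (lam * σ) + 2 * δ * t / σ := by
  rcases le_or_gt δ (σ / 2) with hδσ | hδσ
  · have hVa : V ≤ 2 * a / σ := by
      rw [le_div_iff₀ hσ]
      nlinarith
    have hae : a ≤ e + lam ^ 2 * t * 2 / σ := by
      rcases ha.eq_or_lt with rfl | ha'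
      · positivity
      · have h3 : lam ^ 2 * (t * V) ≤ lam ^ 2 * (t * (2 * a / σ)) := by gcongr
        have h4 : lam ^ 2 * (t * (2 * a / σ)) = a * (lam ^ 2 * t * 2 / σ) := by ring
        have h5 : 0 ≤ lam ^ 2 * V ^ 2 := by positivity
        refine le_of_mul_le_mul_left ?_ ha'
        nlinarith
    have h6 : 2 * a / σ ≤ 2 * (e + lam ^ 2 * t * 2 / σ) / σ := by gcongr
    have h7 : 2 * (e + lam ^ 2 * t * 2 / σ) / σ = 2 * e / σ + 4 * lam ^ 2 * t / σ ^ 2 := by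
      field_simp
      ring
    have h8 : 0 ≤ e * δ / (lam * σ) + 2 * δ * t / σ := by positivity
    linarith
  · have hV' : V ≤ e / (2 * lam) + t := by
      by_contra! hlt
      have h3 : 0 ≤ e / (2 * lam) := by positivity
      have h4 : 2 * (lam * (e / (2 * lam))) = e := by field_simp
      have h5 : a * e - a ^ 2 ≤ (lam * (e / (2 * lam))) ^ 2 := by
        nlinarith [sq_nonneg (a - lam * (e / (2 * lam)))]
      have h6 : (e / (2 * lam)) ^ 2 < V * (V - t) := by nlinarith
      have h7 : lam ^ 2 * (e / (2 * lam)) ^ 2 < lam ^ 2 * (V * (V - t)) :=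
        mul_lt_mul_of_pos_left h6 (by positivity)
      nlinarith
    have h3 : e / (2 * lam) ≤ e * δ / (lam * σ) := by
      rw [div_le_div_iff₀ (by positivity) (by positivity)]
      have : 0 ≤ e * lam := by positivity
      nlinarith
    have h4 : t ≤ 2 * δ * t / σ := by
      rw [le_div_iff₀ hσ]
      nlinarith
    have h5 : 0 ≤ 2 * e / σ + 4 * lam ^ 2 * t / σ ^ 2 := by positivity
    linarith

lemma transpose_mul_mul_pinv {ι κ : Type*} [Fintype ι] [Fintype κ] (A : Matrix ι κ ℝ) :
    Aᵀ * A * pinv A = Aᵀ := by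
  have h : IsMoorePenrose A (pinv A) := (exists_isMoorePenrose A).choose_spec
  calc Aᵀ * A * pinv A = Aᵀ * (A * pinv A)ᵀ := by rw [h.symm_left, Matrix.mul_assoc]
    _ = (A * pinv A * A)ᵀ := by rw [← Matrix.transpose_mul]
    _ = Aᵀ := by rw [h.mul_mul_left]

section Ridge

variable {ι : Type*} [Fintype ι] {p : ℕ}

/-- The normal equations of ridge regression. -/
lemma ridge_normal_equations (M : Matrix ι (Fin p) ℝ) (u : ι → ℝ) (lam : ℝ) :
    (lam ^ 2 • (1 : Matrix (Fin p) (Fin p) ℝ) + Mᵀ * M) *ᵥ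
      (pinv (Matrix.fromRows (lam • (1 : Matrix (Fin p) (Fin p) ℝ)) M) *ᵥ
        (Sum.elim 0 u : Fin p ⊕ ι → ℝ)) = Mᵀ *ᵥ u := by
  set A := Matrix.fromRows (lam • (1 : Matrix (Fin p) (Fin p) ℝ)) M with hA
  have h1 : Aᵀ * A = lam ^ 2 • (1 : Matrix (Fin p) (Fin p) ℝ) + Mᵀ * M := by
    rw [hA, Matrix.transpose_fromRows, Matrix.fromCols_mul_fromRows]
    simp [sq, smul_smul]
  rw [← h1, Matrix.mulVec_mulVec, transpose_mul_mul_pinv, hA, Matrix.transpose_fromRows,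
    Matrix.fromCols_mulVec]
  simp

lemma posDef_ridge (M : Matrix ι (Fin p) ℝ) {lam : ℝ} (hlam : 0 < lam) :
    (lam ^ 2 • (1 : Matrix (Fin p) (Fin p) ℝ) + Mᵀ * M).PosDef := by
  refine Matrix.PosDef.add_posSemidef (Matrix.PosDef.one.smul (by positivity)) ?_
  simpa using Matrix.posSemidef_conjTranspose_mul_self M

lemma continuous_ridge {lam : ℝ} (hlam : 0 < lam) :
    Continuous fun x : (ι → Fin p → ℝ) × (ι → ℝ) =>
      pinv (Matrix.fromRows (lam • (1 : Matrix (Fin p) (Fin p) ℝ)) (Matrix.of x.1)) *ᵥ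
        (Sum.elim 0 x.2 : Fin p ⊕ ι → ℝ) := by
  have h1 : ∀ x : (ι → Fin p → ℝ) × (ι → ℝ),
      pinv (Matrix.fromRows (lam • (1 : Matrix (Fin p) (Fin p) ℝ)) (Matrix.of x.1)) *ᵥ
        (Sum.elim 0 x.2 : Fin p ⊕ ι → ℝ) =
      (lam ^ 2 • (1 : Matrix (Fin p) (Fin p) ℝ) + (Matrix.of x.1)ᵀ * Matrix.of x.1)⁻¹ *ᵥ
        ((Matrix.of x.1)ᵀ *ᵥ x.2) := by
    intro x
    rw [← ridge_normal_equations (Matrix.of x.1) x.2 lam, Matrix.mulVec_mulVec,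
      Matrix.nonsing_inv_mul _ (posDef_ridge _ hlam).det_pos.ne'.isUnit, Matrix.one_mulVec]
  simp only [h1, Matrix.inv_def, Ring.inverse_eq_inv']
  have hM : Continuous fun x : (ι → Fin p → ℝ) × (ι → ℝ) => Matrix.of x.1 := continuous_fst
  have hG : Continuous fun x : (ι → Fin p → ℝ) × (ι → ℝ) =>
      lam ^ 2 • (1 : Matrix (Fin p) (Fin p) ℝ) + (Matrix.of x.1)ᵀ * Matrix.of x.1 :=
    continuous_const.add (hM.matrix_transpose.matrix_mul hM)
  exact ((hG.matrix_det.inv₀ fun x => (posDef_ridge _ hlam).det_pos.ne').smul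
    hG.matrix_adjugate).matrix_mulVec (hM.matrix_transpose.matrix_mulVec continuous_snd)

/-- The operator norm is at most the Frobenius norm. -/
lemma norm_toLpLin_sq_le (M : Matrix ι (Fin p) ℝ) (v : EuclideanSpace ℝ (Fin p)) :
    ‖Matrix.toLpLin 2 2 M v‖ ^ 2 ≤ (∑ i, ∑ k, M i k ^ 2) * ‖v‖ ^ 2 := by
  rw [EuclideanSpace.real_norm_sq_eq, EuclideanSpace.real_norm_sq_eq, Finset.sum_mul]
  refine Finset.sum_le_sum fun i _ => ?_
  simpa [Matrix.mulVec, dotProduct] using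
    Finset.sum_mul_sq_le_sq_mul_sq Finset.univ (fun k => M i k) (fun k => v k)

/-- The error of the ridge estimator computed from a perturbed design `M` and a perturbed response
`u`, when the exact design `M₀` has least singular value at least `σ`. -/
theorem ridge_error_le (M M₀ : Matrix ι (Fin p) ℝ) (u : ι → ℝ) (θ : EuclideanSpace ℝ (Fin p))
    {σ lam : ℝ} (hσ : 0 < σ) (hlam : 0 < lam)
    (hM₀ : ∀ v : EuclideanSpace ℝ (Fin p), σ * ‖v‖ ≤ ‖Matrix.toLpLin 2 2 M₀ v‖) {s : ℝ}
    (hs : 0 ≤ s) (hX : ∑ i, (∑ k, (M i k - M₀ i k) ^ 2 + (u i - (M₀ *ᵥ θ) i) ^ 2) ≤ s ^ 2) :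
    ‖(WithLp.toLp 2 (pinv (Matrix.fromRows (lam • (1 : Matrix (Fin p) (Fin p) ℝ)) M) *ᵥ
        (Sum.elim 0 u : Fin p ⊕ ι → ℝ)) : EuclideanSpace ℝ (Fin p)) - θ‖ ≤
      2 * ((1 + ‖θ‖) * s) / σ + 4 * lam ^ 2 * ‖θ‖ / σ ^ 2 +
        ((1 + ‖θ‖) * s) * s / (lam * σ) + 2 * s * ‖θ‖ / σ := by
  rw [Finset.sum_add_distrib] at hX
  have hA0 : 0 ≤ ∑ i, ∑ k, (M i k - M₀ i k) ^ 2 := by positivity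
  have hB0 : 0 ≤ ∑ i, (u i - (M₀ *ᵥ θ) i) ^ 2 := by positivity
  have hdiff : ∀ v : EuclideanSpace ℝ (Fin p),
      ‖Matrix.toLpLin 2 2 (M - M₀) v‖ ≤ s * ‖v‖ := by
    intro v
    refine (sq_le_sq₀ (norm_nonneg _) (by positivity)).1 ((norm_toLpLin_sq_le _ v).trans ?_)
    rw [mul_pow]
    refine mul_le_mul_of_nonneg_right ?_ (by positivity)
    simp only [Matrix.sub_apply]
    linarith
  set x := pinv (Matrix.fromRows (lam • (1 : Matrix (Fin p) (Fin p) ℝ)) M) *ᵥ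
    (Sum.elim 0 u : Fin p ⊕ ι → ℝ) with hx
  set v : EuclideanSpace ℝ (Fin p) := WithLp.toLp 2 x - θ with hv
  set η : EuclideanSpace ℝ ι := WithLp.toLp 2 u - Matrix.toLpLin 2 2 M θ with hη
  have hη_le : ‖η‖ ≤ (1 + ‖θ‖) * s := by
    have h1 : η = (WithLp.toLp 2 u - Matrix.toLpLin 2 2 M₀ θ) -
        Matrix.toLpLin 2 2 (M - M₀) θ := by
      rw [hη, map_sub, LinearMap.sub_apply]; abel
    have h2 : ‖(WithLp.toLp 2 u : EuclideanSpace ℝ ι) - Matrix.toLpLin 2 2 M₀ θ‖ ≤ s := by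
      refine (sq_le_sq₀ (norm_nonneg _) hs).1 ?_
      rw [EuclideanSpace.real_norm_sq_eq]
      simp only [PiLp.sub_apply, Matrix.toLpLin_apply]
      linarith
    rw [h1]
    have := norm_sub_le ((WithLp.toLp 2 u : EuclideanSpace ℝ ι) - Matrix.toLpLin 2 2 M₀ θ)
      (Matrix.toLpLin 2 2 (M - M₀) θ)
    have h3 := hdiff θ
    linarith
  -- the normal equations, tested against `v`
  have hid : lam ^ 2 * ‖v‖ ^ 2 + ‖Matrix.toLpLin 2 2 M v‖ ^ 2 =
      inner ℝ (Matrix.toLpLin 2 2 M v) η - lam ^ 2 * inner ℝ θ v := by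
    have h1 := ridge_normal_equations M u lam
    rw [← hx, Matrix.add_mulVec, Matrix.smul_mulVec, Matrix.one_mulVec,
      ← Matrix.mulVec_mulVec] at h1
    have h2 := congrArg (fun z => z ⬝ᵥ v.ofLp) h1
    have h3 : ∀ z : ι → ℝ, (Mᵀ *ᵥ z) ⬝ᵥ v.ofLp = z ⬝ᵥ (M *ᵥ v.ofLp) := by
      intro z
      rw [Matrix.mulVec_transpose, Matrix.dotProduct_mulVec]
    have hxv : x = v.ofLp + θ.ofLp := by
      rw [hv]; simp
    simp only [add_dotProduct, smul_dotProduct, h3, smul_eq_mul] at h2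
    rw [hxv, Matrix.mulVec_add, add_dotProduct, add_dotProduct] at h2
    rw [← real_inner_self_eq_norm_sq, ← real_inner_self_eq_norm_sq]
    simp only [EuclideanSpace.inner_eq_star_dotProduct, star_trivial, hη, Matrix.toLpLin_apply,
      WithLp.ofLp_sub, sub_dotProduct]
    rw [dotProduct_comm v.ofLp θ.ofLp]
    linarith
  have h1 : lam ^ 2 * ‖v‖ ^ 2 + ‖Matrix.toLpLin 2 2 M v‖ ^ 2 ≤
      ‖Matrix.toLpLin 2 2 M v‖ * ((1 + ‖θ‖) * s) + lam ^ 2 * (‖θ‖ * ‖v‖) := by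
    rw [hid]
    have h2 := real_inner_le_norm (Matrix.toLpLin 2 2 M v) η
    have h3 := neg_le_of_abs_le (abs_real_inner_le_norm θ v)
    have h4 := mul_le_mul_of_nonneg_left hη_le (norm_nonneg (Matrix.toLpLin 2 2 M v))
    have h5 := mul_le_mul_of_nonneg_left h3 (sq_nonneg lam)
    linarith
  have h2 : σ * ‖v‖ ≤ ‖Matrix.toLpLin 2 2 M v‖ + s * ‖v‖ := by
    have h3 : Matrix.toLpLin 2 2 M₀ v = Matrix.toLpLin 2 2 M v - Matrix.toLpLin 2 2 (M - M₀) v := by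
      rw [map_sub (Matrix.toLpLin 2 2) M M₀, LinearMap.sub_apply]; abel
    have h4 := hM₀ v
    rw [h3] at h4
    have h5 := norm_sub_le (Matrix.toLpLin 2 2 M v) (Matrix.toLpLin 2 2 (M - M₀) v)
    have h6 := hdiff v
    linarith
  exact ridge_scalar_bound (norm_nonneg _) (norm_nonneg _) (by positivity) (norm_nonneg _) hs hσ
    hlam h1 h2

lemma le_sigmaMin (hp : 1 ≤ p) {A : Matrix ι (Fin p) ℝ} {σ : ℝ} (hσ : 0 ≤ σ)
    (hA : ∀ v : EuclideanSpace ℝ (Fin p), σ * ‖v‖ ≤ ‖Matrix.toLpLin 2 2 A v‖) :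
    σ ≤ sigmaMin A := by
  set L := Matrix.toLpLin 2 2 A with hL
  have hlt : p - 1 < Module.finrank ℝ (EuclideanSpace ℝ (Fin p)) := by
    rw [finrank_euclideanSpace_fin]; omega
  obtain ⟨v, hv⟩ := (L.hasEigenvalue_adjoint_comp_self_sq_singularValues hlt).exists_hasEigenvector
  have hv0 : 0 < ‖v‖ := norm_pos_iff.2 hv.2
  have h1 : ‖L v‖ ^ 2 = L.singularValues (p - 1) ^ 2 * ‖v‖ ^ 2 := by
    rw [← real_inner_self_eq_norm_sq, ← LinearMap.adjoint_inner_left, ← LinearMap.comp_apply,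
      hv.apply_eq_smul, real_inner_smul_left, real_inner_self_eq_norm_sq]
    simp
  have h2 : (σ * ‖v‖) ^ 2 ≤ ‖L v‖ ^ 2 := pow_le_pow_left₀ (by positivity) (hA v) 2
  rw [h1, mul_pow] at h2
  exact (sq_le_sq₀ hσ (L.singularValues_nonneg _)).1 (le_of_mul_le_mul_right h2 (by positivity))

end Ridge

/-! ### The least singular value of the regressor matrix -/

lemma numWindows_mul_le {n N s : ℕ} (hsN : s ≤ N) : numWindows n N s * s ≤ n :=
  (Nat.div_mul_le_self _ _).trans (by omega)

lemma mul_add_le_of_lt_numWindows {n N s i : ℕ} (hs : 1 ≤ s)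
    (hi : i < numWindows n N s) : i * s + N ≤ n := by
  have h1 : (i + 1) * s ≤ n + s - N := (Nat.le_div_iff_mul_le hs).1 hi
  rw [add_mul, one_mul] at h1
  omega

lemma lt_numWindows_of_mul_add_le {n N s i : ℕ} (hs : 1 ≤ s) (hi : i * s + N ≤ n) :
    i < numWindows n N s := by
  refine (Nat.le_div_iff_mul_le hs).2 ?_
  rw [Nat.succ_mul]
  omega

lemma windowStart_mem {n N s i : ℕ} {T : ℝ} (hT : 0 < T) (hn : 0 < n) (hi : i * s + N ≤ n) :
    ((i * s : ℕ) : ℝ) * T / n ∈ Set.Icc 0 T := by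
  have hn' : (0 : ℝ) < n := by exact_mod_cast hn
  have h1 : ((i * s : ℕ) : ℝ) ≤ n := by exact_mod_cast (by omega : i * s ≤ n)
  refine ⟨by positivity, ?_⟩
  rw [div_le_iff₀ hn', mul_comm T]
  exact mul_le_mul_of_nonneg_right h1 hT.le

/-- If the windows are short enough, a fixed proportion of them starts at a time within `l` of any
given time. -/
lemma exists_windows_near {T l t : ℝ} (hT : 0 < T) (hl : 0 < l) (hlT : l ≤ T)
    (ht : t ∈ Set.Icc 0 T) {n N s : ℕ} (hn : 0 < n) (hs : 1 ≤ s) (hsN : s ≤ N)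
    (hN : (N : ℝ) * T / n ≤ l / 4) :
    ∃ S : Finset (Fin (numWindows n N s)), l / (4 * T) * numWindows n N s ≤ S.card ∧
      ∀ i ∈ S, |(((i : ℕ) * s : ℕ) : ℝ) * T / n - t| ≤ l := by
  have hn' : (0 : ℝ) < n := by exact_mod_cast hn
  have hs' : (0 : ℝ) < s := by exact_mod_cast hs
  set h : ℝ := s * T / n with hh
  have hh0 : 0 < h := by positivity
  have hhl : h ≤ l / 4 := by
    refine le_trans ?_ hN
    rw [hh]
    gcongr
  set a : ℝ := max (t - l) 0 with ha
  have ha0 : 0 ≤ a := le_max_right _ _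
  have hat : a ≤ t := max_le (by linarith) ht.1
  have hta : t - l ≤ a := le_max_left _ _
  have haT : a ≤ T - l := max_le (by linarith [ht.2]) (by linarith)
  set i₀ := ⌈a / h⌉₊ with hi₀
  set K := ⌊l / (2 * h)⌋₊ with hK
  have hKh : (K : ℝ) * h ≤ l / 2 := by
    have h1 : (K : ℝ) ≤ l / (2 * h) := Nat.floor_le (by positivity)
    rw [le_div_iff₀ (by positivity)] at h1
    linarith
  have hi : ∀ i ∈ Finset.Ico i₀ (i₀ + K), a ≤ i * h ∧ i * h ≤ a + l / 2 := by
    intro i hi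
    obtain ⟨h1, h2⟩ := Finset.mem_Ico.1 hi
    constructor
    · rw [← div_le_iff₀ hh0]
      exact (Nat.le_ceil _).trans (Nat.cast_le.2 h1)
    · have h3 : (i : ℝ) + 1 ≤ i₀ + K := by exact_mod_cast h2
      have h4 : (i₀ : ℝ) < a / h + 1 := Nat.ceil_lt_add_one (by positivity)
      have h5 : (i : ℝ) ≤ a / h + K := by linarith
      have h6 := mul_le_mul_of_nonneg_right h5 hh0.le
      rw [add_mul, div_mul_cancel₀ _ hh0.ne'] at h6
      linarith
  have hih : ∀ i : ℕ, ((i * s : ℕ) : ℝ) * T / n = i * h := by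
    intro i; rw [hh]; push_cast; ring
  have hlt : ∀ i ∈ Finset.Ico i₀ (i₀ + K), i < numWindows n N s := by
    intro i hmem
    refine lt_numWindows_of_mul_add_le hs ?_
    have h1 : ((i * s : ℕ) : ℝ) * T / n + (N : ℝ) * T / n ≤ T := by
      rw [hih]
      linarith [(hi i hmem).2]
    rw [← add_div, div_le_iff₀ hn', ← add_mul, mul_comm T] at h1
    exact_mod_cast le_of_mul_le_mul_right h1 hT
  refine ⟨(Finset.Ico i₀ (i₀ + K)).attachFin hlt, ?_, ?_⟩
  · rw [Finset.card_attachFin, Nat.card_Ico, Nat.add_sub_cancel_left]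
    have h1 : l / (2 * h) - 1 < K := by linarith [Nat.lt_floor_add_one (l / (2 * h))]
    have h2 : 1 ≤ l / (4 * h) := by
      rw [le_div_iff₀ (by positivity)]; linarith
    have h3 : l / (2 * h) = 2 * (l / (4 * h)) := by field_simp; norm_num
    have h4 : (numWindows n N s : ℝ) ≤ T / h := by
      have h5 : (numWindows n N s : ℝ) * s ≤ n := by exact_mod_cast numWindows_mul_le hsN
      have h6 : T / h = n / s := by rw [hh]; field_simp
      rw [h6, le_div_iff₀ hs']
      exact h5
    have h7 : l / (4 * T) * numWindows n N s ≤ l / (4 * T) * (T / h) :=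
      mul_le_mul_of_nonneg_left h4 (by positivity)
    have h8 : l / (4 * T) * (T / h) = l / (4 * h) := by field_simp
    linarith
  · intro i hmem
    obtain ⟨h1, h2⟩ := hi i ((Finset.mem_attachFin hlt).1 hmem)
    rw [hih, abs_le]
    constructor <;> linarith

lemma injective_of_rank_eq {ι : Type*} [Fintype ι] {p : ℕ} {A : Matrix ι (Fin p) ℝ}
    (hA : A.rank = p) : Function.Injective A.mulVecLin := by
  rw [← LinearMap.ker_eq_bot, ← Submodule.finrank_eq_zero (R := ℝ)]
  have h1 := A.mulVecLin.finrank_range_add_finrank_ker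
  have h2 : Module.finrank ℝ A.mulVecLin.range = p := hA
  rw [h2, Module.finrank_fin_fun] at h1
  omega

section

variable {m p : ℕ} {φ : EuclideanSpace ℝ (Fin m) → EuclideanSpace ℝ (Fin p)}
  {θ : EuclideanSpace ℝ (Fin p)} {T : ℝ} {y : ℝ → ℝ}

lemma IsTrajectory.continuousOn_state (hy : IsTrajectory φ θ T y) :
    ContinuousOn (state T y m) (Set.Icc 0 T) :=
  (PiLp.continuous_toLp 2 _).comp_continuousOn
    (continuousOn_pi.2 fun k => (hy.differentiable k k.2.le).continuousOn)

lemma norm_regressors_sq (n N s : ℕ) (v : EuclideanSpace ℝ (Fin p)) :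
    ‖Matrix.toLpLin 2 2 (regressors φ T y n N s) v‖ ^ 2 =
      ∑ i : Fin (numWindows n N s),
        (inner ℝ v (φ (state T y m (((i : ℕ) * s : ℕ) * T / n)))) ^ 2 := by
  rw [EuclideanSpace.real_norm_sq_eq]
  refine Finset.sum_congr rfl fun i _ => ?_
  simp [Matrix.mulVec, regressors, EuclideanSpace.inner_eq_star_dotProduct]

/-- Full rank for a single sample size bounds the regressors below in every direction: the windows
of that one sample size provide finitely many times that suffice for all directions. -/
lemma exists_inner_lower_bound (hT : 0 < T) {n N s : ℕ} (hn : 0 < n) (hs : 1 ≤ s)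
    (hR : (designMatrix φ T y n N s).rank = p) :
    ∃ c > 0, ∀ v : EuclideanSpace ℝ (Fin p), ∃ t ∈ Set.Icc 0 T,
      c * ‖v‖ ≤ |inner ℝ v (φ (state T y m t))| := by
  set A := regressors φ T y n N s with hA
  have hinj : Function.Injective (Matrix.toLpLin 2 2 A) := by
    rw [← LinearMap.ker_eq_bot, LinearMap.ker_eq_bot']
    intro v hv
    have h1 : A *ᵥ v.ofLp = 0 := by
      have := congrArg WithLp.ofLp hv
      simpa using this
    have h2 : (designMatrix φ T y n N s).mulVecLin v.ofLp = 0 := by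
      rw [Matrix.mulVecLin_apply, designMatrix, Matrix.fromRows_mulVec, ← hA, h1]
      funext i
      cases i <;> simp
    have h3 := injective_of_rank_eq hR (h2.trans (map_zero _).symm)
    exact WithLp.ofLp_injective 2 h3
  obtain ⟨K, hK, hanti⟩ := (Matrix.toLpLin 2 2 A).injective_iff_antilipschitz.1 hinj
  have hKv : ∀ v : EuclideanSpace ℝ (Fin p), ‖v‖ ≤ K * ‖Matrix.toLpLin 2 2 A v‖ := fun v =>
    ZeroHomClass.bound_of_antilipschitz (Matrix.toLpLin 2 2 A) hanti v
  have hK' : (0 : ℝ) < K := hK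
  refine ⟨1 / (K * (numWindows n N s + 1)), by positivity, fun v => ?_⟩
  by_contra! H
  rcases eq_or_ne v 0 with rfl | hv
  · have := H 0 ⟨le_rfl, hT.le⟩
    simp at this
  have hv0 : 0 < ‖v‖ := norm_pos_iff.2 hv
  have h1 : ‖Matrix.toLpLin 2 2 A v‖ ^ 2 ≤ numWindows n N s * (1 / (K * (numWindows n N s + 1)) * ‖v‖) ^ 2 := by
    rw [hA, norm_regressors_sq]
    have h2 : ∀ i : Fin (numWindows n N s), (inner ℝ v (φ (state T y m (((i : ℕ) * s : ℕ) * T / n)))) ^ 2 ≤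
        (1 / (K * (numWindows n N s + 1)) * ‖v‖) ^ 2 := by
      intro i
      rw [← sq_abs]
      exact pow_le_pow_left₀ (abs_nonneg _)
        (H _ (windowStart_mem hT hn (mul_add_le_of_lt_numWindows hs i.2))).le 2
    refine (Finset.sum_le_sum fun i _ => h2 i).trans_eq ?_
    simp
  have h2 : ‖v‖ ^ 2 ≤ (K * ‖Matrix.toLpLin 2 2 A v‖) ^ 2 :=
    pow_le_pow_left₀ hv0.le (hKv v) 2
  have h3 : ‖v‖ ^ 2 ≤ numWindows n N s / (numWindows n N s + 1) ^ 2 * ‖v‖ ^ 2 := by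
    calc ‖v‖ ^ 2 ≤ K ^ 2 * ‖Matrix.toLpLin 2 2 A v‖ ^ 2 := by rwa [mul_pow] at h2
      _ ≤ K ^ 2 * (numWindows n N s * (1 / (K * (numWindows n N s + 1)) * ‖v‖) ^ 2) := by gcongr
      _ = _ := by field_simp
  have h4 : (numWindows n N s : ℝ) / (numWindows n N s + 1) ^ 2 < 1 := by
    rw [div_lt_one (by positivity)]
    nlinarith [(Nat.cast_nonneg (numWindows n N s) : (0 : ℝ) ≤ numWindows n N s)]
  nlinarith [pow_pos hv0 2]

/-- The least singular value of the regressor matrix has at least the order of the square root of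
the number of windows. -/
theorem exists_le_norm_regressors (hφ : Continuous φ) (hT : 0 < T) (hy : IsTrajectory φ θ T y)
    {N s : ℕ → ℕ} (hN : Tendsto (fun n => (N n : ℝ) / n) atTop (𝓝 0))
    (hs : ∀ᶠ n in atTop, 1 ≤ s n ∧ s n ≤ N n)
    (hR : ∀ᶠ n in atTop, (designMatrix φ T y n (N n) (s n)).rank = p) :
    ∃ c > 0, ∀ᶠ n in atTop, ∀ v : EuclideanSpace ℝ (Fin p),
      c * √(numWindows n (N n) (s n)) * ‖v‖ ≤
        ‖Matrix.toLpLin 2 2 (regressors φ T y n (N n) (s n)) v‖ := by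
  obtain ⟨n₀, ⟨h1, _⟩, h2, h3⟩ := (hs.and (hR.and (eventually_gt_atTop 0))).exists
  obtain ⟨c, hc, hcv⟩ := exists_inner_lower_bound hT h3 h1 h2
  have hψ : UniformContinuousOn (fun t => φ (state T y m t)) (Set.Icc 0 T) :=
    isCompact_Icc.uniformContinuousOn_of_continuous (hφ.comp_continuousOn hy.continuousOn_state)
  rw [Metric.uniformContinuousOn_iff_le] at hψ
  obtain ⟨l₀, hl₀, hψ⟩ := hψ (c / 2) (half_pos hc)
  set l := min l₀ T with hl_def
  have hl : 0 < l := lt_min hl₀ hT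
  refine ⟨√(l / (4 * T)) * (c / 2), by positivity, ?_⟩
  filter_upwards [hs, eventually_gt_atTop 0,
    (hN.mul_const T).eventually (gt_mem_nhds (show 0 * T < l / 4 by
      rw [zero_mul]; positivity))] with n hsn hn hNn v
  have hNT : (N n : ℝ) * T / n < l / 4 := by
    have : (N n : ℝ) * T / n = N n / n * T := by ring
    rwa [this]
  obtain ⟨t, ht, htv⟩ := hcv v
  obtain ⟨S, hS, hSl⟩ := exists_windows_near hT hl (min_le_right _ _) ht hn hsn.1 hsn.2
    hNT.le
  have hlow : ∀ i ∈ S, (c / 2 * ‖v‖) ^ 2 ≤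
      (inner ℝ v (φ (state T y m (((i : ℕ) * s n : ℕ) * T / n)))) ^ 2 := by
    intro i hi
    rw [← sq_abs (inner ℝ v _)]
    refine pow_le_pow_left₀ (by positivity) ?_ 2
    have h6 := hψ _ (windowStart_mem hT hn (mul_add_le_of_lt_numWindows hsn.1 i.2)) t ht
      ((hSl i hi).trans (min_le_left _ _))
    rw [dist_eq_norm] at h6
    have h7 := abs_real_inner_le_norm v
      (φ (state T y m (((i : ℕ) * s n : ℕ) * T / n)) - φ (state T y m t))
    rw [inner_sub_right] at h7
    have h8 := mul_le_mul_of_nonneg_left h6 (norm_nonneg v)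
    have h9 := abs_sub_abs_le_abs_sub (inner ℝ v (φ (state T y m t)))
      (inner ℝ v (φ (state T y m (((i : ℕ) * s n : ℕ) * T / n))))
    rw [abs_sub_comm] at h9
    linarith
  refine (sq_le_sq₀ (by positivity) (norm_nonneg _)).1 ?_
  rw [norm_regressors_sq]
  calc (√(l / (4 * T)) * (c / 2) * √(numWindows n (N n) (s n)) * ‖v‖) ^ 2
      = (l / (4 * T) * numWindows n (N n) (s n)) * (c / 2 * ‖v‖) ^ 2 := by
        rw [mul_pow, mul_pow, mul_pow, Real.sq_sqrt (by positivity), Real.sq_sqrt (by positivity)]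
        ring
    _ ≤ S.card * (c / 2 * ‖v‖) ^ 2 := mul_le_mul_of_nonneg_right hS (by positivity)
    _ = ∑ i ∈ S, (c / 2 * ‖v‖) ^ 2 := by rw [Finset.sum_const, nsmul_eq_mul]
    _ ≤ ∑ i ∈ S, (inner ℝ v (φ (state T y m (((i : ℕ) * s n : ℕ) * T / n)))) ^ 2 :=
        Finset.sum_le_sum hlow
    _ ≤ _ := Finset.sum_le_sum_of_subset_of_nonneg (Finset.subset_univ _)
        fun i _ _ => sq_nonneg _

end

/-! ### Rates -/

/-- The order `n ^ (-1 / (2 m + 3))` of the root mean square error of the filter, which balances its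
bias and its variance. -/
noncomputable def filterRate (m n : ℕ) : ℝ := (n : ℝ) ^ (-(1 / (2 * m + 3)) : ℝ)

lemma filterRate_pos (m : ℕ) {n : ℕ} (hn : 0 < n) : 0 < filterRate m n :=
  Real.rpow_pos_of_pos (by exact_mod_cast hn) _

lemma filterRate_le_one (m : ℕ) {n : ℕ} (hn : 0 < n) : filterRate m n ≤ 1 :=
  Real.rpow_le_one_of_one_le_of_nonpos (by exact_mod_cast hn)
    (neg_nonpos.2 (by positivity))

lemma filterRate_rpow (m n : ℕ) (α : ℝ) :
    filterRate m n ^ α = (n : ℝ) ^ (-(α / (2 * m + 3)) : ℝ) := by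
  rw [filterRate, ← Real.rpow_mul (Nat.cast_nonneg n)]
  congr 1
  ring

lemma mul_filterRate_pow (m : ℕ) {n : ℕ} (hn : 0 < n) :
    n * filterRate m n ^ (2 * m + 3) = 1 := by
  have hn' : (0 : ℝ) < n := by exact_mod_cast hn
  have hm : (2 * m + 3 : ℝ) ≠ 0 := by positivity
  rw [filterRate, ← Real.rpow_mul_natCast hn'.le]
  push_cast
  rw [neg_mul, one_div_mul_cancel hm, Real.rpow_neg_one, mul_inv_cancel₀ hn'.ne']

lemma rpow_windowExponent (m : ℕ) {n : ℕ} (hn : 0 < n) :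
    (n : ℝ) ^ ((2 * m + 2) / (2 * m + 3) : ℝ) = n * filterRate m n := by
  have hn' : (0 : ℝ) < n := by exact_mod_cast hn
  have hm : (2 * m + 3 : ℝ) ≠ 0 := by positivity
  nth_rewrite 2 [← Real.rpow_one (n : ℝ)]
  rw [filterRate, ← Real.rpow_add hn']
  congr 1
  field_simp
  ring

lemma tendsto_rpow_neg_natCast {b : ℝ} (hb : 0 < b) :
    Tendsto (fun n : ℕ => (n : ℝ) ^ (-b)) atTop (𝓝 0) :=
  (tendsto_rpow_neg_atTop hb).comp tendsto_natCast_atTop_atTop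

lemma exists_bounds_of_isTheta {f g : ℕ → ℝ} (h : f =Θ[atTop] g) :
    ∃ k₁ > 0, ∃ k₂ > 0, ∀ᶠ n in atTop, k₁ * |g n| ≤ |f n| ∧ |f n| ≤ k₂ * |g n| := by
  obtain ⟨k₂, hk₂, h₂⟩ := h.1.exists_pos
  obtain ⟨k, hk, h₁⟩ := h.2.exists_pos
  refine ⟨k⁻¹, inv_pos.2 hk, k₂, hk₂, ?_⟩
  filter_upwards [h₁.bound, h₂.bound] with n hn₁ hn₂
  refine ⟨?_, hn₂⟩
  rw [inv_mul_le_iff₀ hk]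
  exact hn₁

section Windows

variable {m : ℕ} {N : ℕ → ℕ}

lemma exists_windowLength_bounds
    (hN : (fun n => (N n : ℝ)) =Θ[atTop]
      fun n : ℕ => (n : ℝ) ^ ((2 * m + 2) / (2 * m + 3) : ℝ)) :
    ∃ k₁ > 0, ∃ k₂ > 0, ∀ᶠ n in atTop,
      k₁ * (n * filterRate m n) ≤ N n ∧ (N n : ℝ) ≤ k₂ * (n * filterRate m n) := by
  obtain ⟨k₁, hk₁, k₂, hk₂, h⟩ := exists_bounds_of_isTheta hN
  refine ⟨k₁, hk₁, k₂, hk₂, ?_⟩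
  filter_upwards [h, eventually_gt_atTop 0] with n hn hn0
  have := (filterRate_pos m hn0).le
  rwa [rpow_windowExponent m hn0, abs_of_nonneg (by positivity), abs_of_nonneg (by positivity)] at hn

lemma tendsto_windowLength
    (hN : (fun n => (N n : ℝ)) =Θ[atTop]
      fun n : ℕ => (n : ℝ) ^ ((2 * m + 2) / (2 * m + 3) : ℝ)) : Tendsto N atTop atTop := by
  have h1 : Tendsto (fun n : ℕ => (n : ℝ) ^ ((2 * m + 2) / (2 * m + 3) : ℝ)) atTop atTop :=
    (tendsto_rpow_atTop (by positivity)).comp tendsto_natCast_atTop_atTop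
  have h2 := hN.tendsto_norm_atTop_iff.2 (tendsto_norm_atTop_atTop.comp h1)
  refine tendsto_natCast_atTop_iff.1 (h2.congr fun n => ?_)
  simp

lemma tendsto_windowLength_div
    (hN : (fun n => (N n : ℝ)) =Θ[atTop]
      fun n : ℕ => (n : ℝ) ^ ((2 * m + 2) / (2 * m + 3) : ℝ)) :
    Tendsto (fun n => (N n : ℝ) / n) atTop (𝓝 0) := by
  obtain ⟨k₁, _, k₂, hk₂, h⟩ := exists_windowLength_bounds hN
  have h1 : Tendsto (fun n : ℕ => k₂ * filterRate m n) atTop (𝓝 0) := by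
    have := (tendsto_rpow_neg_natCast (b := 1 / (2 * m + 3)) (by positivity)).const_mul k₂
    rwa [mul_zero] at this
  refine tendsto_of_tendsto_of_tendsto_of_le_of_le' tendsto_const_nhds h1
    (Eventually.of_forall fun n => by positivity) ?_
  filter_upwards [h, eventually_gt_atTop 0] with n hn hn0
  have hn' : (0 : ℝ) < n := by exact_mod_cast hn0
  rw [div_le_iff₀ hn']
  linarith [hn.2]

end Windows

/-- With windows of length of order `n ^ ((2 m + 2) / (2 m + 3))`, the filter estimates of all
derivatives up to order `m` have root mean square error of order `filterRate`, uniformly over the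
windows. -/
theorem exists_filterEstimate_rate {m p : ℕ}
    {φ : EuclideanSpace ℝ (Fin m) → EuclideanSpace ℝ (Fin p)} {θ : EuclideanSpace ℝ (Fin p)}
    {T : ℝ} (hT : 0 < T) {y : ℝ → ℝ} (hy : IsTrajectory φ θ T y)
    {Ω : Type*} [MeasurableSpace Ω] {P : Measure Ω} [IsProbabilityMeasure P]
    {w : ℝ → Ω → ℝ} (hw : IsNoise P T w)
    {ρ : ℝ → ℝ} (hpos : ∀ x ∈ Set.Icc (0 : ℝ) 1, 0 < ρ x) (hρ : RiemannIntegrable ρ 0 1)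
    {q : ℕ → ℕ → ℝ[X]} (hq : ∀ N, IsOrthogonalFamily ρ N (q N)) {N : ℕ → ℕ}
    (hN : (fun n => (N n : ℝ)) =Θ[atTop]
      fun n : ℕ => (n : ℝ) ^ ((2 * m + 2) / (2 * m + 3) : ℝ)) :
    ∃ C > 0, ∀ᶠ n in atTop, ∀ d ∈ Finset.range (m + 1), ∀ k : ℕ, k + N n ≤ n →
      MemLp (fun ω => filterEstimate ρ (q (N n)) T n (N n) (sample T y w n ω) k d -
        timeDeriv T y d (k * T / n)) 2 P ∧
      ∫ ω, (filterEstimate ρ (q (N n)) T n (N n) (sample T y w n ω) k d -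
        timeDeriv T y d (k * T / n)) ^ 2 ∂P ≤ C * filterRate m n ^ 2 := by
  obtain ⟨k₁, hk₁, k₂, hk₂, hk⟩ := exists_windowLength_bounds hN
  have hone : ∀ d ∈ Finset.range (m + 1), ∃ C > 0, ∀ᶠ n in atTop, ∀ k : ℕ, k + N n ≤ n →
      MemLp (fun ω => filterEstimate ρ (q (N n)) T n (N n) (sample T y w n ω) k d -
        timeDeriv T y d (k * T / n)) 2 P ∧
      ∫ ω, (filterEstimate ρ (q (N n)) T n (N n) (sample T y w n ω) k d -
        timeDeriv T y d (k * T / n)) ^ 2 ∂P ≤ C * filterRate m n ^ 2 := by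
    intro d hd
    have hdm : d ≤ m := Nat.lt_succ_iff.1 (Finset.mem_range.1 hd)
    obtain ⟨C, hC, h⟩ := exists_filterEstimate_bound hT hy hw hpos hρ hdm
    refine ⟨C * (k₂ ^ 2 + (1 / k₁) ^ (2 * d + 1)), by positivity, ?_⟩
    filter_upwards [(tendsto_windowLength hN).eventually h, hk, eventually_gt_atTop 0]
      with n hn hkn hn0 k hkN
    obtain ⟨h1, h2⟩ := hn (q (N n)) (hq _) n hn0 k hkN
    refine ⟨h1, h2.trans ?_⟩
    rw [mul_assoc]
    refine mul_le_mul_of_nonneg_left ?_ hC.le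
    have hn' : (0 : ℝ) < n := by exact_mod_cast hn0
    have ha := filterRate_pos m hn0
    have ha1 := filterRate_le_one m hn0
    have hna := mul_filterRate_pow m hn0
    set a := filterRate m n
    have hlo : 0 < k₁ * (n * a) := by positivity
    have hN' : (0 : ℝ) < N n := hlo.trans_le hkn.1
    rw [add_mul]
    refine add_le_add ?_ ?_
    · rw [← mul_pow]
      refine pow_le_pow_left₀ (by positivity) ?_ 2
      rw [div_le_iff₀ hn']
      linarith [hkn.2]
    · have h3 : (n : ℝ) / N n ≤ 1 / (k₁ * a) := by
        rw [div_le_div_iff₀ hN' (by positivity)]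
        linarith [hkn.1]
      have h4 : 1 / (N n : ℝ) ≤ 1 / k₁ * a ^ (2 * m + 2) := by
        have h5 : 1 / k₁ * a ^ (2 * m + 2) = 1 / (k₁ * (n * a)) := by
          rw [div_mul_eq_mul_div, one_mul, div_eq_div_iff hk₁.ne' hlo.ne']
          linear_combination k₁ * hna
        rw [h5]
        exact one_div_le_one_div_of_le hlo hkn.1
      calc ((n : ℝ) / N n) ^ (2 * d) / N n = ((n : ℝ) / N n) ^ (2 * d) * (1 / N n) := by ring
        _ ≤ (1 / (k₁ * a)) ^ (2 * d) * (1 / k₁ * a ^ (2 * m + 2)) := by gcongr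
        _ = (1 / k₁) ^ (2 * d + 1) * a ^ (2 * (m - d) + 2) := by
            have h6 : a ^ (2 * m + 2) = a ^ (2 * (m - d) + 2) * a ^ (2 * d) := by
              rw [← pow_add]; congr 1; omega
            rw [h6, ← one_div_mul_one_div, mul_pow, one_div_pow a, pow_succ (1 / k₁)]
            field_simp
        _ ≤ (1 / k₁) ^ (2 * d + 1) * a ^ 2 :=
            mul_le_mul_of_nonneg_left (pow_le_pow_of_le_one ha.le ha1 (by omega)) (by positivity)
  choose! C hC h using hone
  refine ⟨∑ d ∈ Finset.range (m + 1), C d,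
    Finset.sum_pos hC ⟨0, by simp⟩, ?_⟩
  filter_upwards [(Finset.eventually_all _).2 h] with n hn d hd k hk
  refine ⟨(hn d hd k hk).1, (hn d hd k hk).2.trans ?_⟩
  exact mul_le_mul_of_nonneg_right
    (Finset.single_le_sum (f := C) (fun e he => (hC e he).le) hd) (sq_nonneg _)

/-! ### Error of the estimator for given data -/

/-- The sum of the squared errors of the filter estimates of the derivatives of orders `0, …, m`
from the window that follows the index `k`. -/
noncomputable def windowError (m : ℕ) (ρ : ℝ → ℝ) (q : ℕ → ℝ[X]) (T : ℝ) (y : ℝ → ℝ) (n N : ℕ) (z : ℕ → ℝ)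
    (k : ℕ) : ℝ :=
  ∑ d ∈ Finset.range (m + 1), (filterEstimate ρ q T n N z k d - timeDeriv T y d (k * T / n)) ^ 2

lemma windowError_nonneg (m : ℕ) (ρ : ℝ → ℝ) (q : ℕ → ℝ[X]) (T : ℝ) (y : ℝ → ℝ) (n N : ℕ)
    (z : ℕ → ℝ) (k : ℕ) : 0 ≤ windowError m ρ q T y n N z k :=
  Finset.sum_nonneg fun _ _ => sq_nonneg _

/-- This replaces Jensen's inequality in the passage from the second moment of an error `x` of size
`a` to that of `x ^ α`. -/
lemma rpow_sq_le {x a α : ℝ} (hx : 0 ≤ x) (ha : 0 < a) (hα : 0 < α) (hα₁ : α ≤ 1) :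
    (x ^ α) ^ 2 ≤ (a ^ α) ^ 2 * (1 + x ^ 2 / a ^ 2) := by
  have h1 : x = a * (x / a) := by field_simp
  have h2 : ((x / a) ^ α) ^ 2 ≤ 1 + (x / a) ^ 2 := by
    have h0 : 0 ≤ x / a := by positivity
    rcases le_total (x / a) 1 with h | h
    · have h3 := pow_le_one₀ (n := 2) (Real.rpow_nonneg h0 α) (Real.rpow_le_one h0 h hα.le)
      nlinarith [sq_nonneg (x / a)]
    · have h3 : (x / a) ^ α ≤ x / a := by
        simpa using Real.rpow_le_rpow_of_exponent_le h hα₁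
      have h4 := pow_le_pow_left₀ (Real.rpow_nonneg h0 α) h3 2
      linarith
  have h3 : (x ^ α) ^ 2 = (a ^ α) ^ 2 * ((x / a) ^ α) ^ 2 := by
    rw [← mul_pow, ← Real.mul_rpow ha.le (by positivity), ← h1]
  rw [h3, ← div_pow]
  exact mul_le_mul_of_nonneg_left h2 (sq_nonneg _)

section Estimator

variable {m p : ℕ} {φ : EuclideanSpace ℝ (Fin m) → EuclideanSpace ℝ (Fin p)} {α Cφ : ℝ≥0}
  {θ : EuclideanSpace ℝ (Fin p)} {T : ℝ} {y : ℝ → ℝ}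

/-- The contribution of one window to the squared errors of the design and of the response. -/
lemma row_error_le (hα₀ : 0 < α) (hα₁ : α ≤ 1) (hφ : HolderWith Cφ α φ)
    (hy : IsTrajectory φ θ T y) (ρ : ℝ → ℝ) (q : ℕ → ℝ[X]) (n N s i : ℕ) (z : ℕ → ℝ)
    (ht : ((i * s : ℕ) : ℝ) * T / n ∈ Set.Icc 0 T) {a : ℝ} (ha : 0 < a) (ha₁ : a ≤ 1) :
    ∑ k, (φ (stateHat ρ q T n N s z i) k - φ (state T y m ((i * s : ℕ) * T / n)) k) ^ 2 +
      (filterEstimate ρ q T n N z (i * s) m -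
        inner ℝ θ (φ (state T y m ((i * s : ℕ) * T / n)))) ^ 2 ≤
      ((Cφ : ℝ) ^ 2 + 1) *
        ((a ^ (α : ℝ)) ^ 2 * (1 + windowError m ρ q T y n N z (i * s) / a ^ 2)) := by
  have hα₀' : (0 : ℝ) < α := by exact_mod_cast hα₀
  have hα₁' : (α : ℝ) ≤ 1 := by exact_mod_cast hα₁
  set E := windowError m ρ q T y n N z (i * s) with hE
  have hE0 : 0 ≤ E := windowError_nonneg ..
  have hsplit : ‖stateHat ρ q T n N s z i - state T y m ((i * s : ℕ) * T / n)‖ ^ 2 +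
      (filterEstimate ρ q T n N z (i * s) m - timeDeriv T y m ((i * s : ℕ) * T / n)) ^ 2 = E := by
    rw [hE, windowError, Finset.sum_range_succ, EuclideanSpace.real_norm_sq_eq,
      ← Fin.sum_univ_eq_sum_range (fun d => (filterEstimate ρ q T n N z (i * s) d -
        timeDeriv T y d ((i * s : ℕ) * T / n)) ^ 2) m]
    rfl
  rw [← hy.ode _ ht, add_mul, one_mul]
  refine add_le_add ?_ ?_
  · have h1 := hφ.nndist_le (stateHat ρ q T n N s z i) (state T y m ((i * s : ℕ) * T / n))
    have h2 : ‖φ (stateHat ρ q T n N s z i) - φ (state T y m ((i * s : ℕ) * T / n))‖ ≤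
        Cφ * ‖stateHat ρ q T n N s z i - state T y m ((i * s : ℕ) * T / n)‖ ^ (α : ℝ) := by
      rw [← dist_eq_norm, ← dist_eq_norm]
      exact_mod_cast h1
    have h3 := pow_le_pow_left₀ (norm_nonneg _) h2 2
    rw [EuclideanSpace.real_norm_sq_eq, mul_pow] at h3
    refine h3.trans (mul_le_mul_of_nonneg_left
      ((rpow_sq_le (norm_nonneg _) ha hα₀' hα₁').trans ?_) (sq_nonneg _))
    gcongr
    linarith [sq_nonneg (filterEstimate ρ q T n N z (i * s) m -
      timeDeriv T y m ((i * s : ℕ) * T / n))]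
  · have h1 : a ≤ a ^ (α : ℝ) := by
      simpa using Real.rpow_le_rpow_of_exponent_ge ha ha₁ hα₁'
    have h2 : a ^ 2 ≤ (a ^ (α : ℝ)) ^ 2 := pow_le_pow_left₀ ha.le h1 2
    have h3 : E ≤ (a ^ (α : ℝ)) ^ 2 * (E / a ^ 2) := by
      have h4 : a ^ 2 * (E / a ^ 2) = E := by field_simp
      have h5 := mul_le_mul_of_nonneg_right h2 (show 0 ≤ E / a ^ 2 by positivity)
      linarith
    nlinarith [sq_nonneg (a ^ (α : ℝ)), sq_nonneg ‖stateHat ρ q T n N s z i -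
      state T y m ((i * s : ℕ) * T / n)‖]

/-- Insertion of the rates into the bound for the ridge estimator, for `ν = √n'`. -/
lemma ridge_rate_le {ν r σ lam c₁ c₂ c₃ L Q t : ℝ} (hν : 0 < ν) (hr : 0 < r) (hr₁ : r ≤ 1)
    (hc₁ : 0 < c₁) (hc₃ : 0 < c₃) (hL : 0 < L) (hQ : 0 ≤ Q) (ht : 0 ≤ t)
    (hσ : σ = c₃ * ν) (hlam₁ : c₁ * (ν * r) ≤ lam) (hlam₂ : lam ≤ c₂ * (ν * r)) :
    2 * ((1 + t) * (L * (ν * r) * √(1 + Q))) / σ + 4 * lam ^ 2 * t / σ ^ 2 +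
        ((1 + t) * (L * (ν * r) * √(1 + Q))) * (L * (ν * r) * √(1 + Q)) / (lam * σ) +
        2 * (L * (ν * r) * √(1 + Q)) * t / σ ≤
      (2 * (1 + t) * L / c₃ + 4 * c₂ ^ 2 * t / c₃ ^ 2 + (1 + t) * L ^ 2 / (c₁ * c₃) +
        2 * L * t / c₃) * (r * (1 + Q)) := by
  subst hσ
  have hlam : 0 < lam := lt_of_lt_of_le (by positivity) hlam₁
  have hS : √(1 + Q) ≤ 1 + Q := by
    rw [Real.sqrt_le_left (by linarith)]
    nlinarith
  have hSS : √(1 + Q) * √(1 + Q) = 1 + Q := Real.mul_self_sqrt (by linarith)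
  have hS0 := Real.sqrt_nonneg (1 + Q)
  simp only [add_mul _ _ (r * (1 + Q))]
  refine add_le_add (add_le_add (add_le_add ?_ ?_) ?_) ?_
  · calc _ = 2 * (1 + t) * L / c₃ * (r * √(1 + Q)) := by field_simp
      _ ≤ _ := by gcongr
  · calc 4 * lam ^ 2 * t / (c₃ * ν) ^ 2 ≤ 4 * (c₂ * (ν * r)) ^ 2 * t / (c₃ * ν) ^ 2 := by gcongr
      _ = 4 * c₂ ^ 2 * t / c₃ ^ 2 * (r * r) := by field_simp
      _ ≤ _ := by
        gcongr
        linarith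
  · calc _ = (1 + t) * (L * (ν * r)) ^ 2 * (√(1 + Q) * √(1 + Q)) / (lam * (c₃ * ν)) := by ring
      _ = (1 + t) * (L * (ν * r)) ^ 2 * (1 + Q) / (lam * (c₃ * ν)) := by rw [hSS]
      _ ≤ (1 + t) * (L * (ν * r)) ^ 2 * (1 + Q) / (c₁ * (ν * r) * (c₃ * ν)) := by gcongr
      _ = _ := by field_simp
  · calc _ = 2 * L * t / c₃ * (r * √(1 + Q)) := by field_simp
      _ ≤ _ := by gcongr

/-- The error of the estimator for given data is at most a constant times `a ^ α (1 + Q)`, where `Q`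
is the mean over the windows of the squared filter errors, in units of `a ^ 2`. -/
theorem norm_thetaHat_sub_le (hα₀ : 0 < α) (hα₁ : α ≤ 1) (hφ : HolderWith Cφ α φ)
    (hT : 0 < T) (hy : IsTrajectory φ θ T y) (ρ : ℝ → ℝ) (q : ℕ → ℝ[X]) {n N s : ℕ} (hn : 0 < n)
    (hs : 1 ≤ s) (hwin : 0 < numWindows n N s) (z : ℕ → ℝ) {a lam c₁ c₂ c₃ : ℝ} (ha : 0 < a)
    (ha₁ : a ≤ 1) (hc₁ : 0 < c₁) (hc₃ : 0 < c₃)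
    (hreg : ∀ v : EuclideanSpace ℝ (Fin p), c₃ * √(numWindows n N s) * ‖v‖ ≤
      ‖Matrix.toLpLin 2 2 (regressors φ T y n N s) v‖)
    (hlam₁ : c₁ * (√(numWindows n N s) * a ^ (α : ℝ)) ≤ lam)
    (hlam₂ : lam ≤ c₂ * (√(numWindows n N s) * a ^ (α : ℝ))) :
    ‖thetaHat φ ρ q T n N s lam z - θ‖ ≤
      (2 * (1 + ‖θ‖) * √((Cφ : ℝ) ^ 2 + 1) / c₃ + 4 * c₂ ^ 2 * ‖θ‖ / c₃ ^ 2 +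
        (1 + ‖θ‖) * √((Cφ : ℝ) ^ 2 + 1) ^ 2 / (c₁ * c₃) +
        2 * √((Cφ : ℝ) ^ 2 + 1) * ‖θ‖ / c₃) *
      (a ^ (α : ℝ) * (1 + (∑ i : Fin (numWindows n N s),
        windowError m ρ q T y n N z (i * s)) / (numWindows n N s * a ^ 2))) := by
  set Q := (∑ i : Fin (numWindows n N s), windowError m ρ q T y n N z (i * s)) /
    (numWindows n N s * a ^ 2) with hQ
  have hwin' : (0 : ℝ) < numWindows n N s := by exact_mod_cast hwin
  have hQ0 : 0 ≤ Q :=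
    div_nonneg (Finset.sum_nonneg fun i _ => windowError_nonneg ..) (by positivity)
  have hν : 0 < √(numWindows n N s : ℝ) := Real.sqrt_pos.2 hwin'
  have hr : 0 < a ^ (α : ℝ) := Real.rpow_pos_of_pos ha _
  have hL : 0 < √((Cφ : ℝ) ^ 2 + 1) := Real.sqrt_pos.2 (by positivity)
  have hlam : 0 < lam := lt_of_lt_of_le (by positivity) hlam₁
  set M₀ := regressors φ T y n N s with hM₀
  let M : Matrix (Fin (numWindows n N s)) (Fin p) ℝ :=
    Matrix.of fun i k => φ (stateHat ρ q T n N s z i) k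
  let u : Fin (numWindows n N s) → ℝ := fun i => filterEstimate ρ q T n N z (i * s) m
  have hX : ∑ i, (∑ k, (M i k - M₀ i k) ^ 2 + (u i - (M₀ *ᵥ θ) i) ^ 2) ≤
      (√((Cφ : ℝ) ^ 2 + 1) * (√(numWindows n N s) * a ^ (α : ℝ)) * √(1 + Q)) ^ 2 := by
    have hrow : ∀ i, ∑ k, (M i k - M₀ i k) ^ 2 + (u i - (M₀ *ᵥ θ) i) ^ 2 ≤
        ((Cφ : ℝ) ^ 2 + 1) *
          ((a ^ (α : ℝ)) ^ 2 * (1 + windowError m ρ q T y n N z (i * s) / a ^ 2)) := by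
      intro i
      have h1 := row_error_le hα₀ hα₁ hφ hy ρ q n N s i z
        (windowStart_mem hT hn (mul_add_le_of_lt_numWindows hs i.2)) ha ha₁
      have h2 : (M₀ *ᵥ θ) i = inner ℝ θ (φ (state T y m (((i : ℕ) * s : ℕ) * T / n))) := by
        simp [M₀, Matrix.mulVec, regressors, EuclideanSpace.inner_eq_star_dotProduct]
      rw [h2]
      exact h1
    refine (Finset.sum_le_sum fun i _ => hrow i).trans_eq ?_
    rw [mul_pow, mul_pow, mul_pow, Real.sq_sqrt (by positivity), Real.sq_sqrt (by positivity),
      Real.sq_sqrt (by positivity), ← Finset.mul_sum, ← Finset.mul_sum, Finset.sum_add_distrib,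
      ← Finset.sum_div, Finset.sum_const, Finset.card_univ, Fintype.card_fin, nsmul_eq_mul, hQ]
    field_simp
  have h1 := ridge_error_le M M₀ u θ (by positivity : 0 < c₃ * √(numWindows n N s)) hlam hreg
    (by positivity) hX
  have h2 := ridge_rate_le (t := ‖θ‖) hν hr (Real.rpow_le_one ha.le ha₁ α.2) hc₁ hc₃ hL hQ0
    (norm_nonneg _) rfl hlam₁ hlam₂
  exact h1.trans h2

lemma aestronglyMeasurable_thetaHat (hφ : Continuous φ) {Ω : Type*} [MeasurableSpace Ω]
    {P : Measure Ω} (ρ : ℝ → ℝ) (q : ℕ → ℝ[X]) {n N s : ℕ} {z : Ω → ℕ → ℝ} {lam : ℝ}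
    (hlam : 0 < lam)
    (hz : ∀ d ≤ m, ∀ i < numWindows n N s,
      AEMeasurable (fun ω => filterEstimate ρ q T n N (z ω) (i * s) d) P) :
    AEStronglyMeasurable (fun ω => thetaHat φ ρ q T n N s lam (z ω)) P := by
  have hstate : ∀ i : Fin (numWindows n N s),
      AEMeasurable (fun ω => φ (stateHat ρ q T n N s (z ω) i)) P := by
    intro i
    have h1 : AEMeasurable (fun ω (d : Fin m) => filterEstimate ρ q T n N (z ω) (i * s) d) P :=
      aemeasurable_pi_lambda _ fun d => hz d d.2.le i i.2
    have h2 : Continuous fun x : Fin m → ℝ => φ (WithLp.toLp 2 x) :=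
      hφ.comp (PiLp.continuous_toLp 2 _)
    exact h2.measurable.comp_aemeasurable h1
  have hentry : ∀ (i : Fin (numWindows n N s)) (k : Fin p),
      AEMeasurable (fun ω => φ (stateHat ρ q T n N s (z ω) i) k) P := by
    intro i k
    have h1 : Continuous fun x : EuclideanSpace ℝ (Fin p) => x k := by fun_prop
    exact h1.measurable.comp_aemeasurable (hstate i)
  have hpair : AEMeasurable (fun ω =>
      ((fun i k => φ (stateHat ρ q T n N s (z ω) i) k,
        fun i => filterEstimate ρ q T n N (z ω) (i * s) m) :
        (Fin (numWindows n N s) → Fin p → ℝ) × (Fin (numWindows n N s) → ℝ))) P :=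
    AEMeasurable.prodMk
      (aemeasurable_pi_lambda _ fun i => aemeasurable_pi_lambda _ fun k => hentry i k)
      (aemeasurable_pi_lambda _ fun i => hz m le_rfl i i.2)
  have hcont := (PiLp.continuous_toLp 2 fun _ : Fin p => ℝ).comp
    (continuous_ridge (ι := Fin (numWindows n N s)) (p := p) hlam)
  have hmeas := hcont.comp_aestronglyMeasurable hpair.aestronglyMeasurable
  simp only [thetaHat, designMatrixHat, responseHat]
  exact hmeas

end Estimator

/-! ### The rate of the expected error -/

section Expectation

variable {m : ℕ} {Ω : Type*} [MeasurableSpace Ω] {P : Measure Ω} {ρ : ℝ → ℝ} {q : ℕ → ℝ[X]}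
  {T : ℝ} {y : ℝ → ℝ} {n N k : ℕ} {z : Ω → ℕ → ℝ}

lemma integrable_windowError
    (hz : ∀ d ∈ Finset.range (m + 1), MemLp (fun ω => filterEstimate ρ q T n N (z ω) k d -
      timeDeriv T y d (k * T / n)) 2 P) :
    Integrable (fun ω => windowError m ρ q T y n N (z ω) k) P :=
  integrable_finsetSum _ fun d hd => (hz d hd).integrable_sq

lemma integral_windowError_le {b : ℝ}
    (hz : ∀ d ∈ Finset.range (m + 1), MemLp (fun ω => filterEstimate ρ q T n N (z ω) k d -
      timeDeriv T y d (k * T / n)) 2 P)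
    (hb : ∀ d ∈ Finset.range (m + 1), ∫ ω, (filterEstimate ρ q T n N (z ω) k d -
      timeDeriv T y d (k * T / n)) ^ 2 ∂P ≤ b) :
    ∫ ω, windowError m ρ q T y n N (z ω) k ∂P ≤ (m + 1) * b := by
  simp only [windowError]
  rw [integral_finsetSum _ fun d hd => (hz d hd).integrable_sq]
  refine (Finset.sum_le_sum hb).trans_eq ?_
  simp

end Expectation

end Hyperjerk

open Hyperjerk

theorem theorem2
    -- the model
    {m p : ℕ} (hm : 1 ≤ m) (hp : 1 ≤ p)
    (φ : EuclideanSpace ℝ (Fin m) → EuclideanSpace ℝ (Fin p))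
    (α Cφ : ℝ≥0) (hα₀ : 0 < α) (hα₁ : α ≤ 1) (hφ : HolderWith Cφ α φ)
    (T : ℝ) (hT : 0 < T)
    (θ : EuclideanSpace ℝ (Fin p)) (y : ℝ → ℝ) (hy : Hyperjerk.IsTrajectory φ θ T y)
    -- the noise
    {Ω : Type*} [MeasurableSpace Ω] (P : Measure Ω) [IsProbabilityMeasure P]
    (w : ℝ → Ω → ℝ) (hw : Hyperjerk.IsNoise P T w)
    -- the differentiation filter: weight and orthogonal polynomials
    (ρ : ℝ → ℝ) (hρ_pos : ∀ x ∈ Set.Icc (0 : ℝ) 1, 0 < ρ x)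
    (hρ_int : Hyperjerk.RiemannIntegrable ρ 0 1)
    (q : ℕ → ℕ → ℝ[X]) (hq : ∀ N, Hyperjerk.IsOrthogonalFamily ρ N (q N))
    -- window length, and spacing of the windows (from overlapping to disjoint)
    (N s : ℕ → ℕ)
    (hN : (fun n => (N n : ℝ)) =Θ[atTop]
      fun n : ℕ => (n : ℝ) ^ ((2 * m + 2) / (2 * m + 3) : ℝ))
    (hs : ∀ᶠ n in atTop, 1 ≤ s n ∧ s n ≤ N n)
    -- identifiability
    (hR : ∀ᶠ n in atTop, (Hyperjerk.designMatrix φ T y n (N n) (s n)).rank = p)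
    -- choice of the regularization coefficient
    (lam : ℕ → ℝ) (hlam_pos : ∀ᶠ n in atTop, 0 < lam n)
    (hlam : lam =Θ[atTop] fun n : ℕ =>
      √(Hyperjerk.numWindows n (N n) (s n)) * (n : ℝ) ^ (-(α / (2 * m + 3)) : ℝ)) :
    (∀ᶠ n in atTop, lam n < Hyperjerk.sigmaMin (Hyperjerk.regressors φ T y n (N n) (s n))) ∧
    (∀ᶠ n in atTop, Integrable (fun ω =>
      Hyperjerk.thetaHat φ ρ (q (N n)) T n (N n) (s n) (lam n)
        (Hyperjerk.sample T y w n ω) - θ) P) ∧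
    (fun n => ∫ ω, ‖Hyperjerk.thetaHat φ ρ (q (N n)) T n (N n) (s n) (lam n)
        (Hyperjerk.sample T y w n ω) - θ‖ ∂P) =O[atTop]
      fun n : ℕ => (n : ℝ) ^ (-(α / (2 * m + 3)) : ℝ) := by
  have hφc : Continuous φ := hφ.continuous hα₀
  obtain ⟨c₃, hc₃, hreg⟩ :=
    exists_le_norm_regressors hφc hT hy (tendsto_windowLength_div hN) hs hR
  obtain ⟨C, hC, herr⟩ := exists_filterEstimate_rate hT hy hw hρ_pos hρ_int hq hN
  obtain ⟨c₁, hc₁, c₂, hc₂, hbd⟩ := exists_bounds_of_isTheta hlam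
  have hlam' : ∀ᶠ n in atTop,
      c₁ * (√(numWindows n (N n) (s n)) * filterRate m n ^ (α : ℝ)) ≤ lam n ∧
        lam n ≤ c₂ * (√(numWindows n (N n) (s n)) * filterRate m n ^ (α : ℝ)) := by
    filter_upwards [hbd, hlam_pos] with n hn hpos
    rwa [abs_of_pos hpos, abs_of_nonneg (mul_nonneg (Real.sqrt_nonneg _)
      (Real.rpow_nonneg (Nat.cast_nonneg _) _)), ← filterRate_rpow] at hn
  have hwin : ∀ᶠ n in atTop, 0 < numWindows n (N n) (s n) := by
    filter_upwards [hs, eventually_gt_atTop 0,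
      (tendsto_windowLength_div hN).eventually (gt_mem_nhds one_pos)] with n hsn hn hNn
    refine lt_numWindows_of_mul_add_le hsn.1 ?_
    rw [div_lt_one (by exact_mod_cast hn), Nat.cast_lt] at hNn
    omega
  -- `lam n / √n'` tends to zero, so `lam n` falls below the least singular value
  have hrate : Tendsto (fun n : ℕ => c₂ * filterRate m n ^ (α : ℝ)) atTop (𝓝 0) := by
    have hα : (0 : ℝ) < α := by exact_mod_cast hα₀
    have := (tendsto_rpow_neg_natCast (b := α / (2 * m + 3)) (by positivity)).const_mul c₂
    simp only [filterRate_rpow]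
    rwa [mul_zero] at this
  obtain ⟨K, hK⟩ : ∃ K : ℝ, K = 2 * (1 + ‖θ‖) * √((Cφ : ℝ) ^ 2 + 1) / c₃ +
      4 * c₂ ^ 2 * ‖θ‖ / c₃ ^ 2 + (1 + ‖θ‖) * √((Cφ : ℝ) ^ 2 + 1) ^ 2 / (c₁ * c₃) +
        2 * √((Cφ : ℝ) ^ 2 + 1) * ‖θ‖ / c₃ := ⟨_, rfl⟩
  have hK0 : 0 ≤ K := by rw [hK]; positivity
  have hmain : ∀ᶠ n in atTop, Integrable (fun ω => thetaHat φ ρ (q (N n)) T n (N n) (s n) (lam n)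
        (sample T y w n ω) - θ) P ∧
      ∫ ω, ‖thetaHat φ ρ (q (N n)) T n (N n) (s n) (lam n) (sample T y w n ω) - θ‖ ∂P ≤
        K * (1 + (m + 1) * C) * filterRate m n ^ (α : ℝ) := by
    filter_upwards [hreg, herr, hlam', hwin, hs, hlam_pos, eventually_gt_atTop 0]
      with n hreg herr hlam' hwin hs hlam_pos hn
    have ha := filterRate_pos m hn
    have hwin' : (0 : ℝ) < numWindows n (N n) (s n) := by exact_mod_cast hwin
    -- the deterministic bound, for each realization of the noise
    have hpt := fun ω => norm_thetaHat_sub_le hα₀ hα₁ hφ hT hy ρ (q (N n)) hn hs.1 hwin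
      (sample T y w n ω) ha (filterRate_le_one m hn) hc₁ hc₃ hreg hlam'.1 hlam'.2
    rw [← hK] at hpt
    have hidx : ∀ i < numWindows n (N n) (s n), i * s n + N n ≤ n := fun i hi =>
      mul_add_le_of_lt_numWindows hs.1 hi
    have hint : ∀ i : Fin (numWindows n (N n) (s n)), Integrable (fun ω =>
        windowError m ρ (q (N n)) T y n (N n) (sample T y w n ω) (i * s n)) P := fun i =>
      integrable_windowError fun d hd => (herr d hd _ (hidx i i.2)).1
    have hle : ∀ i : Fin (numWindows n (N n) (s n)), ∫ ω,
        windowError m ρ (q (N n)) T y n (N n) (sample T y w n ω) (i * s n) ∂P ≤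
          (m + 1) * (C * filterRate m n ^ 2) := fun i =>
      integral_windowError_le (fun d hd => (herr d hd _ (hidx i i.2)).1)
        fun d hd => (herr d hd _ (hidx i i.2)).2
    have hQint : Integrable (fun ω => (∑ i : Fin (numWindows n (N n) (s n)),
        windowError m ρ (q (N n)) T y n (N n) (sample T y w n ω) (i * s n)) /
          (numWindows n (N n) (s n) * filterRate m n ^ 2)) P :=
      (integrable_finsetSum _ fun i _ => hint i).div_const _
    have hQle : ∫ ω, (∑ i : Fin (numWindows n (N n) (s n)),
        windowError m ρ (q (N n)) T y n (N n) (sample T y w n ω) (i * s n)) /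
          (numWindows n (N n) (s n) * filterRate m n ^ 2) ∂P ≤ (m + 1) * C := by
      rw [integral_div, integral_finsetSum _ fun i _ => hint i, div_le_iff₀ (by positivity)]
      refine (Finset.sum_le_sum fun i _ => hle i).trans_eq ?_
      rw [Finset.sum_const, Finset.card_univ, Fintype.card_fin, nsmul_eq_mul]
      ring
    have hBint := (((integrable_const (1 : ℝ)).add hQint).const_mul
      (filterRate m n ^ (α : ℝ))).const_mul K
    have hmeas : AEStronglyMeasurable (fun ω => thetaHat φ ρ (q (N n)) T n (N n) (s n) (lam n)
        (sample T y w n ω)) P := by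
      refine aestronglyMeasurable_thetaHat hφc ρ (q (N n)) hlam_pos fun d hd i hi => ?_
      have h := (herr d (Finset.mem_range.2 (by omega)) _ (hidx i hi)).1.1.aemeasurable.add_const
        (timeDeriv T y d ((i * s n : ℕ) * T / n))
      simpa only [sub_add_cancel] using h
    have hthint := hBint.mono' (hmeas.sub aestronglyMeasurable_const) (Eventually.of_forall hpt)
    refine ⟨hthint, (integral_mono hthint.norm hBint hpt).trans ?_⟩
    rw [integral_const_mul, integral_const_mul, integral_add' (integrable_const _) hQint,
      integral_const]
    simp only [probReal_univ, smul_eq_mul, mul_one]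
    have hr : 0 ≤ K * filterRate m n ^ (α : ℝ) := mul_nonneg hK0 (Real.rpow_nonneg ha.le _)
    nlinarith [mul_le_mul_of_nonneg_left hQle hr]
  refine ⟨?_, hmain.mono fun n hn => hn.1, ?_⟩
  · filter_upwards [hreg, hlam', hwin, hrate.eventually (gt_mem_nhds hc₃)]
      with n hreg hlam' hwin hlt
    have hν : 0 < √(numWindows n (N n) (s n) : ℝ) := Real.sqrt_pos.2 (by exact_mod_cast hwin)
    refine lt_of_lt_of_le ?_ (le_sigmaMin hp (by positivity) hreg)
    have := mul_lt_mul_of_pos_right hlt hν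
    linarith [hlam'.2]
  · refine IsBigO.of_bound (K * (1 + (m + 1) * C)) ?_
    filter_upwards [hmain] with n hn
    rw [Real.norm_of_nonneg (integral_nonneg fun ω => norm_nonneg _),
      Real.norm_of_nonneg (Real.rpow_nonneg (Nat.cast_nonneg _) _), ← filterRate_rpow]
    exact hn.2
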